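/- Identify $\mathbb R^2$ with $\mathbb C$ and let $\mathbb S=\mathbb R/2\pi\mathbb Z$. For a smooth immersed closed curve $\gamma:\mathbb S\to\mathbb R^2$ let $s$ be arclength, $\tau=\gamma_s=(\tau_1,\tau_2)$, $\nu=(-\tau_2,\tau_1)$, $k=\langle\gamma_{ss},\nu\rangle$, let $L[\gamma]$ be the length, and put $$E[\gamma]=\tfrac12\int_\gamma k_s^2\,ds,\qquad (L^3E)[\gamma]=L[\gamma]^3E[\gamma],\qquad \mathcal K[\gamma]=k_{ssss}+k_{ss}k^2-\tfrac12k_s^2k .$$ The winding number of $\gamma$ is $\frac1{2\pi}\int_\gamma k\,ds\in\mathbb Z$. An ideal curve flow with initial curve $\gamma_0$ is a smooth family of immersed closed curves $\gamma:\mathbb S\times[0,\infty)\to\mathbb R^2$, smooth up to $t=0$, with $\gamma(\cdot,0)=\gamma_0$ and $\partial_t\gamma=\mathcal K\,\nu$; write $\gamma_t=\gamma(\cdot,t)$. Let $\omega\in\mathbb Z$. There are constants $0<\varepsilon_2\le\varepsilon_1<\varepsilon_0$ and $C_\omega,C_0,C_1>0$ depending only on $\omega$, and a function $C_3$ of $\omega$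 and two real variables, such that the following hold. (a) Every smooth immersed closed curve $\eta$ of winding number $\omega$ with $(L^3E)[\eta]<\varepsilon_0$ satisfies $\int_\eta\mathcal K^2\,ds\ge C_\omega L[\eta]^{-6}E[\eta]$. Now let $\gamma_0$ be a smooth immersed closed curve of winding number $\omega$ and $\gamma:\mathbb S\times[0,\infty)\to\mathbb R^2$ an ideal curve flow with initial curve $\gamma_0$. (b) If $(L^3E)[\gamma_0]<\varepsilon_1$, then $(L^3E)[\gamma_t]\le(L^3E)[\gamma_0]$ for all $t\ge0$. (c) If $(L^3E)[\gamma_0]<\varepsilon_2$, then for all $t\ge0$ the function $r\mapsto L[\gamma_r]^3\int_{\gamma_r}\mathcal K^2\,ds$ is integrable on $[0,t]$, $$\int_0^tL[\gamma_r]^3\int_{\gamma_r}\mathcal K^2\,ds\,dr\le C_0\big((L^3E)[\gamma_0]-(L^3E)[\gamma_t]\big),$$ and the length satisfies the upper bound $$L[\gamma_t]\le L[\gamma_0]\exp\big(C_1\,(L^3E)[\gamma_0]\big)$$ and the lower bound $$L[\gamma_t]\ge L[\gamma_0]\exp(-C_3),\qquad C_3=C_3\big(\omega,E[\gamma_0],L[\gamma_0]\big).$$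 -/

import Mathlib

namespace IdealCurve

noncomputable section

open scoped ContDiff

/- The plane `ℝ²` is `ℂ` with its Euclidean norm and real inner product, and the circle is
`ℝ / 2πℤ`: a map on the circle is a `2π`-periodic map on `ℝ`. -/

/-- A smooth closed immersed planar curve `γ : 𝕊 → ℝ²`. -/
structure IsClosedImmersed (γ : ℝ → ℂ) : Prop where
  smooth : ContDiff ℝ ∞ γ
  periodic : Function.Periodic γ (2 * Real.pi)
  immersed : ∀ u, deriv γ u ≠ 0

/-- The arclength derivative `f_s = f_u / |γ_u|` along `γ`. -/
def arcDeriv {F : Type*} [NormedAddCommGroup F] [NormedSpace ℝ F] (γ : ℝ → ℂ) (f : ℝ → F) :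
    ℝ → F :=
  fun u => ‖deriv γ u‖⁻¹ • deriv f u

/-- The integral `∫_γ f ds` with respect to arclength. -/
def arcIntegral (γ : ℝ → ℂ) (f : ℝ → ℝ) : ℝ :=
  ∫ u in (0 : ℝ)..(2 * Real.pi), f u * ‖deriv γ u‖

/-- The unit tangent `τ = γ_s`. -/
def tangent (γ : ℝ → ℂ) : ℝ → ℂ := arcDeriv γ γ

/-- The unit normal `ν = (-τ₂, τ₁)`. -/
def normal (γ : ℝ → ℂ) : ℝ → ℂ := fun u => ⟨-(tangent γ u).im, (tangent γ u).re⟩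

/-- The curvature `k = ⟨γ_ss, ν⟩`. -/
def curvature (γ : ℝ → ℂ) : ℝ → ℝ :=
  fun u => inner ℝ (arcDeriv γ (arcDeriv γ γ) u) (normal γ u)

/-- The `n`-th arclength derivative of the curvature. -/
def curvatureDeriv (γ : ℝ → ℂ) (n : ℕ) : ℝ → ℝ := (arcDeriv γ)^[n] (curvature γ)

/-- The length `L[γ]`. -/
def length (γ : ℝ → ℂ) : ℝ := arcIntegral γ (fun _ => 1)

/-- The energy `E[γ] = ½ ∫_γ k_s² ds`. -/
def energy (γ : ℝ → ℂ) : ℝ := 1 / 2 * arcIntegral γ (fun u => curvatureDeriv γ 1 u ^ 2)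

/-- The scale-invariant energy `(L³E)[γ]`. -/
def scaledEnergy (γ : ℝ → ℂ) : ℝ := length γ ^ 3 * energy γ

/-- The winding number `(1 / 2π) ∫_γ k ds` of the tangent. -/
def windingNumber (γ : ℝ → ℂ) : ℝ := 1 / (2 * Real.pi) * arcIntegral γ (curvature γ)

/-- The operator `𝒦[γ] = k_{ssss} + k_{ss} k² - ½ k_s² k`. -/
def idealOp (γ : ℝ → ℂ) : ℝ → ℝ := fun u =>
  curvatureDeriv γ 4 u + curvatureDeriv γ 2 u * curvature γ u ^ 2
    - 1 / 2 * curvatureDeriv γ 1 u ^ 2 * curvature γ u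

/-- The square `‖𝒦‖₂² = ∫_γ 𝒦² ds` of the `L²(ds)` norm. -/
def idealOpNormSq (γ : ℝ → ℂ) : ℝ := arcIntegral γ (fun u => idealOp γ u ^ 2)

/-- `γ : 𝕊 × [0, ∞) → ℝ²`, written `γ t u`, is an ideal curve flow with initial curve `γ₀`:
a family of closed immersed curves, smooth on `𝕊 × [0, ∞)` (up to `t = 0`), that solves
`∂_t γ = 𝒦 ν`. The time derivative is one-sided at `t = 0`; the values of `γ` at negative
times play no role. -/
structure IsIdealFlow (γ₀ : ℝ → ℂ) (γ : ℝ → ℝ → ℂ) : Prop where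
  smooth : ContDiffOn ℝ ∞ (fun p : ℝ × ℝ => γ p.1 p.2) (Set.Ici 0 ×ˢ Set.univ)
  closed_immersed : ∀ t, 0 ≤ t → IsClosedImmersed (γ t)
  initial : γ 0 = γ₀
  evolution : ∀ t, 0 ≤ t → ∀ u,
    HasDerivWithinAt (fun r => γ r u) (idealOp (γ t) u • normal (γ t) u) (Set.Ici 0) t

end

end IdealCurve

/-! Everything rests on two estimates for a single curve with `L³E` small, the first of which is the
coercivity (a). Write `Q = ∫ 𝒦² ds`, `X = ∫ |𝒦| ds`.

Translation invariance of the energy gives a vector `J = k_sss ν + (k k_ss - ½ k_s²) τ` with `J_s =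
𝒦 ν`, so `J` differs from the constant `c = J(0)` by at most `X`. The constant is controlled because
the curve closes up: `⟨c, J⟩` equals, up to an exact derivative, a combination of `k_s²` and `(k -
κ)²` terms, where `κ = 2πω/L` is the mean curvature. Hence `|c| L ≤ 2XL + A·2E`
(`norm_noetherCurrent_zero_le`). Since `k_sss` is the normal component of `J`, it is bounded by `3X
+ A·2E/L`. Both `k_s` and `k_ss` vanish somewhere, so each integration costs a factor `L`; by
Cauchy–Schwarz `X² ≤ LQ`, and the term quadratic in `E` is absorbed when `L³E` is small. This gives
`2E ≤ 36 L⁶Q` and `∫ k_ss² ≤ 36 L⁴Q` (`coercivity_aux`).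

Along the flow `E' = -Q` and `L' = -∫ k𝒦 ds`, with `∫ k𝒦 = ∫ k_ss² - (7/2) ∫ k² k_s²`. As `|k| ≤
B/L`, the two estimates bound `L'` on both sides by multiples of `L⁴Q`. Then `(L³E)' ≤ -½ L³Q` while
`L³E` is below a threshold, and a barrier argument keeps it there; the winding number, on which the
constants depend, is conserved. Integration gives the bound on `∫ L³Q dt`, and since `|(log L)'|` is
at most a multiple of `L³Q`, both length bounds follow. -/

namespace IdealCurve

open scoped ContDiff Topology
open Set

/-! ### Arclength calculus and the Frenet equations -/

section Calculus

variable {γ : ℝ → ℂ} {F : Type*} [NormedAddCommGroup F] [NormedSpace ℝ F]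

lemma IsClosedImmersed.speed_pos (h : IsClosedImmersed γ) (u : ℝ) : 0 < ‖deriv γ u‖ :=
  norm_pos_iff.2 (h.immersed u)

lemma contDiff_deriv {f : ℝ → F} (hf : ContDiff ℝ ∞ f) : ContDiff ℝ ∞ (deriv f) :=
  (contDiff_infty_iff_deriv.1 hf).2

lemma periodic_deriv {f : ℝ → F} {T : ℝ} (hf : Function.Periodic f T) :
    Function.Periodic (deriv f) T := by
  intro u
  rw [← deriv_comp_add_const]
  congr 1
  exact funext hf

lemma IsClosedImmersed.contDiff_speed (h : IsClosedImmersed γ) :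
    ContDiff ℝ ∞ (fun u => ‖deriv γ u‖) :=
  (contDiff_deriv h.smooth).norm ℝ h.immersed

lemma IsClosedImmersed.continuous_speed (h : IsClosedImmersed γ) :
    Continuous (fun u => ‖deriv γ u‖) := h.contDiff_speed.continuous

lemma IsClosedImmersed.contDiff_arcDeriv (h : IsClosedImmersed γ) {f : ℝ → F}
    (hf : ContDiff ℝ ∞ f) : ContDiff ℝ ∞ (arcDeriv γ f) :=
  (h.contDiff_speed.inv fun u => (h.speed_pos u).ne').smul (contDiff_deriv hf)

lemma IsClosedImmersed.periodic_arcDeriv (h : IsClosedImmersed γ) {f : ℝ → F}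
    (hf : Function.Periodic f (2 * Real.pi)) :
    Function.Periodic (arcDeriv γ f) (2 * Real.pi) := by
  intro u
  simp only [arcDeriv, periodic_deriv h.periodic u, periodic_deriv hf u]

lemma IsClosedImmersed.hasDerivAt_smul (h : IsClosedImmersed γ) {f : ℝ → F}
    (hf : ContDiff ℝ ∞ f) (u : ℝ) : HasDerivAt f (‖deriv γ u‖ • arcDeriv γ f u) u := by
  have h1 : HasDerivAt f (deriv f u) u :=
    (hf.differentiable (by simp) u).hasDerivAt
  rwa [arcDeriv, smul_inv_smul₀ (h.speed_pos u).ne']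

lemma IsClosedImmersed.contDiff_tangent (h : IsClosedImmersed γ) : ContDiff ℝ ∞ (tangent γ) :=
  h.contDiff_arcDeriv h.smooth

lemma normal_eq (γ : ℝ → ℂ) : normal γ = fun u => Complex.I * tangent γ u := by
  funext u
  apply Complex.ext <;> simp [normal]

lemma IsClosedImmersed.contDiff_normal (h : IsClosedImmersed γ) : ContDiff ℝ ∞ (normal γ) := by
  rw [normal_eq]
  exact contDiff_const.mul h.contDiff_tangent

lemma IsClosedImmersed.periodic_tangent (h : IsClosedImmersed γ) :
    Function.Periodic (tangent γ) (2 * Real.pi) := h.periodic_arcDeriv h.periodic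

lemma IsClosedImmersed.periodic_normal (h : IsClosedImmersed γ) :
    Function.Periodic (normal γ) (2 * Real.pi) := by
  intro u
  simp only [normal, h.periodic_tangent u]

lemma IsClosedImmersed.contDiff_curvature (h : IsClosedImmersed γ) :
    ContDiff ℝ ∞ (curvature γ) :=
  (h.contDiff_arcDeriv h.contDiff_tangent).inner ℝ h.contDiff_normal

lemma IsClosedImmersed.periodic_curvature (h : IsClosedImmersed γ) :
    Function.Periodic (curvature γ) (2 * Real.pi) := by
  intro u
  simp only [curvature, h.periodic_normal u,
    h.periodic_arcDeriv (h.periodic_arcDeriv h.periodic) u]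

lemma curvatureDeriv_succ (γ : ℝ → ℂ) (n : ℕ) :
    curvatureDeriv γ (n + 1) = arcDeriv γ (curvatureDeriv γ n) :=
  Function.iterate_succ_apply' _ _ _

lemma IsClosedImmersed.contDiff_curvatureDeriv (h : IsClosedImmersed γ) (n : ℕ) :
    ContDiff ℝ ∞ (curvatureDeriv γ n) := by
  induction n with
  | zero => exact h.contDiff_curvature
  | succ n ih => rw [curvatureDeriv_succ]; exact h.contDiff_arcDeriv ih

lemma IsClosedImmersed.continuous_curvatureDeriv (h : IsClosedImmersed γ) (n : ℕ) :
    Continuous (curvatureDeriv γ n) := (h.contDiff_curvatureDeriv n).continuous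

lemma IsClosedImmersed.periodic_curvatureDeriv (h : IsClosedImmersed γ) (n : ℕ) :
    Function.Periodic (curvatureDeriv γ n) (2 * Real.pi) := by
  induction n with
  | zero => exact h.periodic_curvature
  | succ n ih => rw [curvatureDeriv_succ]; exact h.periodic_arcDeriv ih

lemma IsClosedImmersed.hasDerivAt (h : IsClosedImmersed γ) {f : ℝ → ℝ}
    (hf : ContDiff ℝ ∞ f) (u : ℝ) : HasDerivAt f (arcDeriv γ f u * ‖deriv γ u‖) u := by
  simpa [mul_comm] using h.hasDerivAt_smul hf u

lemma IsClosedImmersed.hasDerivAt_curvature (h : IsClosedImmersed γ) (u : ℝ) :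
    HasDerivAt (curvature γ) (curvatureDeriv γ 1 u * ‖deriv γ u‖) u :=
  h.hasDerivAt h.contDiff_curvature u

lemma IsClosedImmersed.hasDerivAt_curvatureDeriv (h : IsClosedImmersed γ) (n : ℕ) (u : ℝ) :
    HasDerivAt (curvatureDeriv γ n) (curvatureDeriv γ (n + 1) u * ‖deriv γ u‖) u := by
  rw [curvatureDeriv_succ]
  exact h.hasDerivAt (h.contDiff_curvatureDeriv n) u

lemma IsClosedImmersed.contDiff_idealOp (h : IsClosedImmersed γ) : ContDiff ℝ ∞ (idealOp γ) :=
  ((h.contDiff_curvatureDeriv 4).add ((h.contDiff_curvatureDeriv 2).mul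
    (h.contDiff_curvature.pow 2))).sub ((contDiff_const.mul
    ((h.contDiff_curvatureDeriv 1).pow 2)).mul h.contDiff_curvature)

lemma IsClosedImmersed.continuous_idealOp (h : IsClosedImmersed γ) : Continuous (idealOp γ) :=
  h.contDiff_idealOp.continuous

lemma IsClosedImmersed.periodic_idealOp (h : IsClosedImmersed γ) :
    Function.Periodic (idealOp γ) (2 * Real.pi) := by
  intro u
  simp only [idealOp, h.periodic_curvatureDeriv _ u, h.periodic_curvature u]

lemma IsClosedImmersed.norm_tangent (h : IsClosedImmersed γ) (u : ℝ) : ‖tangent γ u‖ = 1 := by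
  simp [tangent, arcDeriv, (h.speed_pos u).ne']

lemma IsClosedImmersed.tangent_sq (h : IsClosedImmersed γ) (u : ℝ) :
    (tangent γ u).re ^ 2 + (tangent γ u).im ^ 2 = 1 := by
  have := Complex.sq_norm (tangent γ u)
  rw [h.norm_tangent, Complex.normSq_apply] at this
  linarith

/-- The Frenet equation `τ_s = k ν`. -/
lemma IsClosedImmersed.arcDeriv_tangent (h : IsClosedImmersed γ) (u : ℝ) :
    arcDeriv γ (tangent γ) u = curvature γ u • normal γ u := by
  have hd : HasDerivAt (tangent γ) (deriv (tangent γ) u) u :=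
    (h.contDiff_tangent.differentiable (by simp) u).hasDerivAt
  have hre : HasDerivAt (fun w => (tangent γ w).re) (deriv (tangent γ) u).re u :=
    (Complex.reCLM.hasFDerivAt.comp_hasDerivAt u hd)
  have him : HasDerivAt (fun w => (tangent γ w).im) (deriv (tangent γ) u).im u :=
    (Complex.imCLM.hasFDerivAt.comp_hasDerivAt u hd)
  -- Differentiating `|τ|² = 1` shows that `τ_s` is orthogonal to `τ`, hence a multiple of `ν`.
  have h0 := (hre.pow 2).add (him.pow 2)
  have h1 : ((fun w => (tangent γ w).re) ^ 2 + (fun w => (tangent γ w).im) ^ 2) = fun _ => 1 :=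
    funext fun w => h.tangent_sq w
  rw [h1] at h0
  have h2 := h0.unique (hasDerivAt_const u (1 : ℝ))
  have h3 := h.tangent_sq u
  have hs : arcDeriv γ (tangent γ) u = ‖deriv γ u‖⁻¹ • deriv (tangent γ) u := rfl
  have h4 : (arcDeriv γ (tangent γ) u).re * (tangent γ u).re
      + (arcDeriv γ (tangent γ) u).im * (tangent γ u).im = 0 := by
    rw [hs]
    simp only [Complex.real_smul, Complex.mul_re, Complex.mul_im, Complex.ofReal_re,
      Complex.ofReal_im]
    norm_num at h2
    linear_combination (‖deriv γ u‖⁻¹ / 2) * h2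
  have hk : curvature γ u = -(arcDeriv γ (tangent γ) u).re * (tangent γ u).im
      + (arcDeriv γ (tangent γ) u).im * (tangent γ u).re := by
    change inner ℝ (arcDeriv γ (tangent γ) u) (normal γ u) = _
    simp [Complex.inner, normal]
    ring
  rw [hk]
  apply Complex.ext
  · simp only [normal, Complex.real_smul, Complex.mul_re, Complex.ofReal_re, Complex.ofReal_im]
    linear_combination (-(arcDeriv γ (tangent γ) u).re) * h3 + (tangent γ u).re * h4
  · simp only [normal, Complex.real_smul, Complex.mul_im, Complex.ofReal_re, Complex.ofReal_im]
    linear_combination (-(arcDeriv γ (tangent γ) u).im) * h3 + (tangent γ u).im * h4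

lemma IsClosedImmersed.hasDerivAt_self (h : IsClosedImmersed γ) (u : ℝ) :
    HasDerivAt γ (‖deriv γ u‖ • tangent γ u) u := h.hasDerivAt_smul h.smooth u

lemma IsClosedImmersed.hasDerivAt_tangent (h : IsClosedImmersed γ) (u : ℝ) :
    HasDerivAt (tangent γ) ((curvature γ u * ‖deriv γ u‖) • normal γ u) u := by
  have := h.hasDerivAt_smul h.contDiff_tangent u
  rwa [h.arcDeriv_tangent, smul_smul, mul_comm] at this

lemma IsClosedImmersed.hasDerivAt_normal (h : IsClosedImmersed γ) (u : ℝ) :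
    HasDerivAt (normal γ) (-(curvature γ u * ‖deriv γ u‖) • tangent γ u) u := by
  have := (h.hasDerivAt_tangent u).const_mul Complex.I
  rw [normal_eq] at this ⊢
  refine this.congr_deriv ?_
  simp only [Complex.real_smul, Complex.ofReal_neg]
  linear_combination ((↑(curvature γ u * ‖deriv γ u‖) : ℂ) * tangent γ u) * Complex.I_sq

end Calculus

/-! ### Arclength integrals, Cauchy–Schwarz and Poincaré-type bounds -/

section Integral

variable {γ : ℝ → ℂ}

lemma IsClosedImmersed.intervalIntegrable (h : IsClosedImmersed γ) {f : ℝ → ℝ}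
    (hf : Continuous f) (a b : ℝ) :
    IntervalIntegrable (fun u => f u * ‖deriv γ u‖) MeasureTheory.volume a b :=
  (hf.mul h.continuous_speed).intervalIntegrable _ _

lemma IsClosedImmersed.arcIntegral_add (h : IsClosedImmersed γ) {f g : ℝ → ℝ}
    (hf : Continuous f) (hg : Continuous g) :
    arcIntegral γ (fun u => f u + g u) = arcIntegral γ f + arcIntegral γ g := by
  simp only [arcIntegral, add_mul]
  exact intervalIntegral.integral_add (h.intervalIntegrable hf _ _) (h.intervalIntegrable hg _ _)

lemma arcIntegral_const_mul (γ : ℝ → ℂ) (c : ℝ) (f : ℝ → ℝ) :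
    arcIntegral γ (fun u => c * f u) = c * arcIntegral γ f := by
  simp only [arcIntegral, mul_assoc]
  exact intervalIntegral.integral_const_mul _ _

lemma arcIntegral_const (γ : ℝ → ℂ) (c : ℝ) :
    arcIntegral γ (fun _ => c) = c * length γ := by
  rw [length, ← arcIntegral_const_mul, mul_one]

lemma IsClosedImmersed.arcIntegral_mono (h : IsClosedImmersed γ) {f g : ℝ → ℝ}
    (hf : Continuous f) (hg : Continuous g) (hfg : ∀ u ∈ Icc 0 (2 * Real.pi), f u ≤ g u) :
    arcIntegral γ f ≤ arcIntegral γ g :=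
  intervalIntegral.integral_mono_on Real.two_pi_pos.le (h.intervalIntegrable hf _ _)
    (h.intervalIntegrable hg _ _)
    fun u hu => mul_le_mul_of_nonneg_right (hfg u hu) (norm_nonneg _)

lemma arcIntegral_nonneg {f : ℝ → ℝ} (hf : ∀ u, 0 ≤ f u) : 0 ≤ arcIntegral γ f :=
  intervalIntegral.integral_nonneg Real.two_pi_pos.le
    fun u _ => mul_nonneg (hf u) (norm_nonneg _)

lemma arcIntegral_eq_zero {G g : ℝ → ℝ} (h : IsClosedImmersed γ)
    (hG : ∀ u, HasDerivAt G (g u * ‖deriv γ u‖) u) (hg : Continuous g)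
    (hper : Function.Periodic G (2 * Real.pi)) : arcIntegral γ g = 0 := by
  rw [arcIntegral, intervalIntegral.integral_eq_sub_of_hasDerivAt (fun u _ => hG u)
    (h.intervalIntegrable hg _ _)]
  have := hper 0
  rw [zero_add] at this
  rw [this, sub_self]

lemma IsClosedImmersed.length_pos (h : IsClosedImmersed γ) : 0 < length γ := by
  exact intervalIntegral.intervalIntegral_pos_of_pos (h.intervalIntegrable continuous_const _ _)
    (fun u => by simpa using h.immersed u) Real.two_pi_pos

lemma IsClosedImmersed.sq_arcIntegral_abs_le (h : IsClosedImmersed γ) {f : ℝ → ℝ}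
    (hf : Continuous f) :
    arcIntegral γ (fun u => |f u|) ^ 2 ≤ length γ * arcIntegral γ (fun u => f u ^ 2) := by
  have hL := h.length_pos
  set X := arcIntegral γ (fun u => |f u|)
  set x := X / length γ
  -- Cauchy–Schwarz from the nonnegativity of `∫ (|f| - x)² ds`, with `x` the mean of `|f|`.
  have h1 : (0 : ℝ) ≤ arcIntegral γ (fun u => (f u ^ 2 + (-2 * x) * |f u|) + x ^ 2) :=
    arcIntegral_nonneg fun u => by nlinarith [sq_nonneg (|f u| - x), sq_abs (f u)]
  rw [h.arcIntegral_add (by fun_prop) (by fun_prop), h.arcIntegral_add (by fun_prop)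
    (by fun_prop), arcIntegral_const_mul, arcIntegral_const] at h1
  have h2 : X = x * length γ := by simp only [x]; field_simp
  rw [h2]
  have h3 : arcIntegral γ (fun u => |f u|) = x * length γ := h2
  rw [h3] at h1
  nlinarith

lemma IsClosedImmersed.norm_sub_le_arcIntegral {F : Type*} [NormedAddCommGroup F]
    [NormedSpace ℝ F] [CompleteSpace F] (h : IsClosedImmersed γ) {f f' : ℝ → F} {g : ℝ → ℝ}
    (hf : ∀ u, HasDerivAt f (f' u) u) (hc : Continuous f') (hg : Continuous g)
    (hfg : ∀ u, ‖f' u‖ ≤ g u * ‖deriv γ u‖) {a b : ℝ} (ha : a ∈ Icc 0 (2 * Real.pi))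
    (hb : b ∈ Icc 0 (2 * Real.pi)) : ‖f b - f a‖ ≤ arcIntegral γ g := by
  wlog hab : a ≤ b generalizing a b
  · rw [norm_sub_rev]
    exact this hb ha (le_of_not_ge hab)
  rw [← intervalIntegral.integral_eq_sub_of_hasDerivAt (fun u _ => hf u)
    (hc.intervalIntegrable _ _)]
  calc ‖∫ u in a..b, f' u‖ ≤ ∫ u in a..b, ‖f' u‖ :=
        intervalIntegral.norm_integral_le_integral_norm hab
    _ ≤ ∫ u in a..b, g u * ‖deriv γ u‖ :=
        intervalIntegral.integral_mono_on hab (hc.norm.intervalIntegrable _ _)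
          (h.intervalIntegrable hg _ _) fun u _ => hfg u
    _ ≤ arcIntegral γ g :=
        intervalIntegral.integral_mono_interval ha.1 hab hb.2
          (Filter.Eventually.of_forall fun u => (norm_nonneg _).trans (hfg u))
          (h.intervalIntegrable hg _ _)

lemma IsClosedImmersed.abs_sub_le_arcIntegral (h : IsClosedImmersed γ) {f g : ℝ → ℝ}
    (hf : ∀ u, HasDerivAt f (g u * ‖deriv γ u‖) u) (hg : Continuous g) {a b : ℝ}
    (ha : a ∈ Icc 0 (2 * Real.pi)) (hb : b ∈ Icc 0 (2 * Real.pi)) :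
    |f b - f a| ≤ arcIntegral γ (fun u => |g u|) :=
  h.norm_sub_le_arcIntegral hf (hg.mul h.continuous_speed) hg.abs
    (fun u => by simp) ha hb

/-- A function with an arclength primitive that is periodic has a zero. -/
lemma IsClosedImmersed.exists_zero (h : IsClosedImmersed γ) {f g : ℝ → ℝ}
    (hf : ∀ u, HasDerivAt f (g u * ‖deriv γ u‖) u) (hper : f 0 = f (2 * Real.pi)) :
    ∃ a ∈ Icc 0 (2 * Real.pi), g a = 0 := by
  obtain ⟨a, ha, h0⟩ := exists_hasDerivAt_eq_zero Real.two_pi_pos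
    (fun u _ => (hf u).continuousAt.continuousWithinAt) hper (fun u _ => hf u)
  exact ⟨a, Ioo_subset_Icc_self ha, (mul_eq_zero.1 h0).resolve_right (h.speed_pos a).ne'⟩

/-- A function with vanishing arclength integral has a zero. -/
lemma IsClosedImmersed.exists_zero_of_arcIntegral_eq_zero (h : IsClosedImmersed γ) {g : ℝ → ℝ}
    (hg : Continuous g) (h0 : arcIntegral γ g = 0) : ∃ a ∈ Icc 0 (2 * Real.pi), g a = 0 :=
  h.exists_zero (f := fun u => ∫ w in (0 : ℝ)..u, g w * ‖deriv γ w‖)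
    (fun u => (hg.mul h.continuous_speed).integral_hasStrictDerivAt 0 u |>.hasDerivAt)
    (by simpa [arcIntegral] using h0.symm)

/-- By Rolle a derivative of a periodic function vanishes somewhere; integrating from that zero
costs one factor `L`. The shift to `n + 1` is needed since `k` itself need not vanish. -/
lemma IsClosedImmersed.abs_curvatureDeriv_le (h : IsClosedImmersed γ) (n : ℕ) {M : ℝ}
    (hM : ∀ u ∈ Icc 0 (2 * Real.pi), |curvatureDeriv γ (n + 2) u| ≤ M) :
    ∀ u ∈ Icc 0 (2 * Real.pi), |curvatureDeriv γ (n + 1) u| ≤ length γ * M := by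
  intro u hu
  obtain ⟨a, ha, h0⟩ := h.exists_zero (h.hasDerivAt_curvatureDeriv n)
    (by simpa using (h.periodic_curvatureDeriv n 0).symm)
  have h1 := h.abs_sub_le_arcIntegral (h.hasDerivAt_curvatureDeriv (n + 1))
    (h.continuous_curvatureDeriv _) ha hu
  rw [h0, sub_zero] at h1
  refine h1.trans ((h.arcIntegral_mono (h.continuous_curvatureDeriv _).abs continuous_const
    hM).trans_eq ?_)
  rw [arcIntegral_const, mul_comm]

end Integral

/-! ### The Noether current and coercivity of `𝒦` -/

section Static

variable {γ : ℝ → ℂ}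

/-- The translation Noether current of the ideal energy, whose arclength derivative is `𝒦 ν`. -/
noncomputable def noetherCurrent (γ : ℝ → ℂ) (u : ℝ) : ℂ :=
  curvatureDeriv γ 3 u • normal γ u
    + (curvature γ u * curvatureDeriv γ 2 u - 1 / 2 * curvatureDeriv γ 1 u ^ 2) • tangent γ u

/-- In `J_s` the tangential terms cancel: `-k k_sss` from `ν_s` against the derivative of `k k_ss`,
and `k_s k_ss` against that of `½ k_s²`. -/
lemma IsClosedImmersed.hasDerivAt_noetherCurrent (h : IsClosedImmersed γ) (u : ℝ) :
    HasDerivAt (noetherCurrent γ) ((idealOp γ u * ‖deriv γ u‖) • normal γ u) u := by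
  have h0 := h.hasDerivAt_curvature u
  have h1 := h.hasDerivAt_curvatureDeriv 1 u
  have h2 := h.hasDerivAt_curvatureDeriv 2 u
  have h3 := h.hasDerivAt_curvatureDeriv 3 u
  have := (h3.smul (h.hasDerivAt_normal u)).add
    (((h0.mul h2).sub ((h1.pow 2).const_mul (1 / 2))).smul (h.hasDerivAt_tangent u))
  refine this.congr_deriv ?_
  simp only [idealOp, Complex.real_smul, Pi.mul_apply, Pi.sub_apply, Pi.pow_apply]
  push_cast
  ring

lemma inner_normal_tangent (γ : ℝ → ℂ) (u : ℝ) : inner ℝ (normal γ u) (tangent γ u) = 0 := by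
  simp [Complex.inner, normal]
  ring

lemma IsClosedImmersed.inner_tangent_self (h : IsClosedImmersed γ) (u : ℝ) :
    inner ℝ (tangent γ u) (tangent γ u) = 1 := by
  rw [real_inner_self_eq_norm_sq, h.norm_tangent, one_pow]

lemma IsClosedImmersed.norm_normal (h : IsClosedImmersed γ) (u : ℝ) : ‖normal γ u‖ = 1 := by
  simp [normal_eq, h.norm_tangent]

lemma IsClosedImmersed.inner_normal_self (h : IsClosedImmersed γ) (u : ℝ) :
    inner ℝ (normal γ u) (normal γ u) = 1 := by
  rw [real_inner_self_eq_norm_sq, h.norm_normal, one_pow]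

lemma IsClosedImmersed.sq_inner_add_sq_inner (h : IsClosedImmersed γ) (c : ℂ) (u : ℝ) :
    inner ℝ c (tangent γ u) ^ 2 + inner ℝ c (normal γ u) ^ 2 = ‖c‖ ^ 2 := by
  rw [Complex.sq_norm, Complex.normSq_apply]
  simp only [Complex.inner, normal, Complex.mul_re, Complex.conj_re, Complex.conj_im]
  linear_combination (c.re ^ 2 + c.im ^ 2) * h.tangent_sq u

lemma IsClosedImmersed.inner_noetherCurrent_tangent (h : IsClosedImmersed γ) (u : ℝ) :
    inner ℝ (noetherCurrent γ u) (tangent γ u)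
      = curvature γ u * curvatureDeriv γ 2 u - 1 / 2 * curvatureDeriv γ 1 u ^ 2 := by
  rw [noetherCurrent, inner_add_left, real_inner_smul_left, real_inner_smul_left,
    inner_normal_tangent, h.inner_tangent_self]
  ring

lemma IsClosedImmersed.inner_noetherCurrent_normal (h : IsClosedImmersed γ) (u : ℝ) :
    inner ℝ (noetherCurrent γ u) (normal γ u) = curvatureDeriv γ 3 u := by
  rw [noetherCurrent, inner_add_left, real_inner_smul_left, real_inner_smul_left,
    h.inner_normal_self, real_inner_comm, inner_normal_tangent]
  ring

lemma IsClosedImmersed.norm_noetherCurrent_sub_le (h : IsClosedImmersed γ) {a b : ℝ}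
    (ha : a ∈ Icc 0 (2 * Real.pi)) (hb : b ∈ Icc 0 (2 * Real.pi)) :
    ‖noetherCurrent γ b - noetherCurrent γ a‖ ≤ arcIntegral γ (fun u => |idealOp γ u|) :=
  h.norm_sub_le_arcIntegral h.hasDerivAt_noetherCurrent
    ((h.continuous_idealOp.mul h.continuous_speed).smul h.contDiff_normal.continuous)
    h.continuous_idealOp.abs
    (fun u => by rw [norm_smul, h.norm_normal]; simp) ha hb

/-- The closing condition tested against a constant vector. -/
lemma IsClosedImmersed.arcIntegral_noether (h : IsClosedImmersed γ) (c : ℂ) (κ : ℝ) :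
    arcIntegral γ (fun u => inner ℝ c (tangent γ u)
        * (curvature γ u * curvatureDeriv γ 2 u - 1 / 2 * curvatureDeriv γ 1 u ^ 2)
      + inner ℝ c (normal γ u) * curvatureDeriv γ 3 u
      + 5 / 2 * (inner ℝ c (tangent γ u) * curvatureDeriv γ 1 u ^ 2)
      + 2 / 3 * ((curvature γ u - κ) ^ 2
        * (curvature γ u ^ 2 + 2 * curvature γ u * κ + 3 * κ ^ 2)
        * inner ℝ c (tangent γ u))) = 0 := by
  have hk := h.contDiff_curvature.continuous
  have hk1 := h.continuous_curvatureDeriv 1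
  have hk2 := h.continuous_curvatureDeriv 2
  have hk3 := h.continuous_curvatureDeriv 3
  have ht := h.contDiff_tangent.continuous
  have hn := h.contDiff_normal.continuous
  -- The first three terms of the primitive reduce `⟨c, J⟩` to `p k_s²` and `k⁴ p`, where `p = ⟨c,
  -- τ⟩`. Closedness makes `∫ p` and `∫ k p` vanish, so the last two terms may subtract from `k⁴`
  -- its tangent line at `κ`; what remains is `k⁴ - 4κ³k + 3κ⁴ = (k - κ)² (k² + 2kκ + 3κ²)`,
  -- quadratically small.
  refine arcIntegral_eq_zero h (G := fun u => inner ℝ c (normal γ u) * curvatureDeriv γ 2 u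
    + 2 * (inner ℝ c (tangent γ u) * curvature γ u * curvatureDeriv γ 1 u)
    - 2 / 3 * (curvature γ u ^ 3 * inner ℝ c (normal γ u))
    + 8 / 3 * κ ^ 3 * inner ℝ c (normal γ u) + 2 * κ ^ 4 * inner ℝ c (γ u))
    (fun u => ?_) (by fun_prop) (fun u => ?_)
  · have d0 := h.hasDerivAt_curvature u
    have d1 := h.hasDerivAt_curvatureDeriv 1 u
    have d2 := h.hasDerivAt_curvatureDeriv 2 u
    have dp := (hasDerivAt_const u c).inner ℝ (h.hasDerivAt_tangent u)
    have dq := (hasDerivAt_const u c).inner ℝ (h.hasDerivAt_normal u)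
    have dg := (hasDerivAt_const u c).inner ℝ (h.hasDerivAt_self u)
    have := ((((dq.mul d2).add (((dp.mul d0).mul d1).const_mul 2)).sub
      (((d0.pow 3).mul dq).const_mul (2 / 3))).add (dq.const_mul (8 / 3 * κ ^ 3))).add
      (dg.const_mul (2 * κ ^ 4))
    refine this.congr_deriv ?_
    simp only [real_inner_smul_right, inner_zero_left, Pi.mul_apply, Pi.pow_apply]
    push_cast
    ring
  · simp only [h.periodic_normal u, h.periodic_curvatureDeriv _ u, h.periodic_tangent u,
      h.periodic_curvature u, h.periodic u]

lemma energy_nonneg (γ : ℝ → ℂ) : 0 ≤ energy γ :=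
  mul_nonneg (by norm_num) (arcIntegral_nonneg fun _ => sq_nonneg _)

lemma idealOpNormSq_nonneg (γ : ℝ → ℂ) : 0 ≤ idealOpNormSq γ :=
  arcIntegral_nonneg fun _ => sq_nonneg _

lemma arcIntegral_sq_eq (γ : ℝ → ℂ) :
    arcIntegral γ (fun u => curvatureDeriv γ 1 u ^ 2) = 2 * energy γ := by
  rw [energy]; ring

/-- The curvature is close to its mean `2πω / L` in terms of the energy. -/
lemma IsClosedImmersed.sq_curvature_sub_le (h : IsClosedImmersed γ) {w : ℝ}
    (hw : windingNumber γ = w) {u : ℝ} (hu : u ∈ Icc 0 (2 * Real.pi)) :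
    (curvature γ u - 2 * Real.pi * w / length γ) ^ 2 ≤ length γ * (2 * energy γ) := by
  have hL := h.length_pos
  have hk := h.contDiff_curvature.continuous
  have hpi := Real.pi_pos
  -- `2πw/L` is the mean of `k`, so `k` attains it and `∫ |k_s|` bounds the deviation.
  have h0 : arcIntegral γ (fun u => curvature γ u + -(2 * Real.pi * w / length γ)) = 0 := by
    rw [h.arcIntegral_add hk continuous_const, arcIntegral_const, ← hw, windingNumber]
    field_simp
    ring
  obtain ⟨a, ha, hz⟩ := h.exists_zero_of_arcIntegral_eq_zero (by fun_prop) h0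
  have h1 := h.abs_sub_le_arcIntegral h.hasDerivAt_curvature (h.continuous_curvatureDeriv 1) ha hu
  have h2 := h.sq_arcIntegral_abs_le (h.continuous_curvatureDeriv 1)
  rw [arcIntegral_sq_eq] at h2
  rw [show 2 * Real.pi * w / length γ = curvature γ a by linarith, ← sq_abs]
  exact (pow_le_pow_left₀ (abs_nonneg _) h1 2).trans h2

/-- The bound of `L |k|` for curves of winding number `w` with small scale-invariant energy. -/
noncomputable def curvatureBound (w : ℝ) : ℝ := 2 * Real.pi * |w| + 1

/-- The constant that governs the coercivity of `𝒦`. -/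
noncomputable def coercivityConst (w : ℝ) : ℝ := 4 * curvatureBound w ^ 2 + 3

/-- The smallness threshold for the coercivity of `𝒦`. -/
noncomputable def coercivityThreshold (w : ℝ) : ℝ := 1 / (8 * coercivityConst w ^ 2)

lemma one_le_curvatureBound (w : ℝ) : 1 ≤ curvatureBound w := by
  have := mul_nonneg Real.two_pi_pos.le (abs_nonneg w)
  unfold curvatureBound
  linarith

lemma coercivityThreshold_pos (w : ℝ) : 0 < coercivityThreshold w := by
  unfold coercivityThreshold coercivityConst
  positivity

lemma coercivityThreshold_le (w : ℝ) : coercivityThreshold w ≤ 1 / 2 := by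
  unfold coercivityThreshold coercivityConst
  apply one_div_le_one_div_of_le (by norm_num)
  nlinarith [sq_nonneg (curvatureBound w), sq_nonneg (curvatureBound w ^ 2)]

variable {w : ℝ}

lemma IsClosedImmersed.abs_curvature_le (h : IsClosedImmersed γ) (hw : windingNumber γ = w)
    (hE : scaledEnergy γ ≤ coercivityThreshold w) {u : ℝ} (hu : u ∈ Icc 0 (2 * Real.pi)) :
    |curvature γ u| ≤ curvatureBound w / length γ := by
  have hL := h.length_pos
  have h1 := h.sq_curvature_sub_le hw hu
  -- The threshold is at most `1/2`, so `2L³E ≤ 1` and the squared deviation is at most `1/L²`.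
  have h2 : |curvature γ u - 2 * Real.pi * w / length γ| ≤ 1 / length γ := by
    apply abs_le_of_sq_le_sq _ (by positivity)
    refine h1.trans ?_
    rw [div_pow, one_pow, le_div_iff₀ (by positivity)]
    have := hE.trans (coercivityThreshold_le w)
    unfold scaledEnergy at this
    nlinarith
  have h3 : |2 * Real.pi * w / length γ| = 2 * Real.pi * |w| / length γ := by
    rw [abs_div, abs_mul, abs_of_pos hL, abs_of_pos Real.two_pi_pos]
  have h4 := abs_add_le (curvature γ u - 2 * Real.pi * w / length γ)
    (2 * Real.pi * w / length γ)
  rw [sub_add_cancel, h3] at h4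
  rw [curvatureBound, add_div]
  linarith

lemma quartic_remainder_le {k κ b : ℝ} (hk : |k| ≤ b) (hκ : |κ| ≤ b) :
    |k ^ 2 + 2 * k * κ + 3 * κ ^ 2| ≤ 6 * b ^ 2 := by
  have hk2 : k ^ 2 ≤ b ^ 2 := sq_le_sq' (abs_le.1 hk).1 (abs_le.1 hk).2
  have hκ2 : κ ^ 2 ≤ b ^ 2 := sq_le_sq' (abs_le.1 hκ).1 (abs_le.1 hκ).2
  rw [abs_le]
  constructor <;> nlinarith [sq_nonneg (k - κ), sq_nonneg (k + κ)]

/-- Testing the closing condition with `c = J(0)` itself: then `⟨c, J⟩` is `|c|²` up to `2|c|X`,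
while its integral is of order `|c| E`. -/
lemma IsClosedImmersed.norm_noetherCurrent_zero_le (h : IsClosedImmersed γ)
    (hw : windingNumber γ = w) (hE : scaledEnergy γ ≤ coercivityThreshold w) :
    ‖noetherCurrent γ 0‖ * length γ ≤ 2 * arcIntegral γ (fun u => |idealOp γ u|) * length γ
      + coercivityConst w * (2 * energy γ) := by
  have hL := h.length_pos
  have hk := h.contDiff_curvature.continuous
  have hk1 := h.continuous_curvatureDeriv 1
  have hk2 := h.continuous_curvatureDeriv 2
  have hk3 := h.continuous_curvatureDeriv 3
  have ht := h.contDiff_tangent.continuous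
  have hn := h.contDiff_normal.continuous
  set L := length γ with hLdef
  set B := curvatureBound w with hB
  have hB1 : 1 ≤ B := one_le_curvatureBound w
  set X := arcIntegral γ (fun u => |idealOp γ u|) with hX
  set c := noetherCurrent γ 0 with hc
  set κ := 2 * Real.pi * w / L with hκ
  set m := ‖c‖ with hm
  have hm0 : 0 ≤ m := norm_nonneg _
  have hE0 := energy_nonneg γ
  have hX0 : 0 ≤ X := arcIntegral_nonneg fun _ => abs_nonneg _
  have hκle : |κ| ≤ B / L := by
    rw [hκ, abs_div, abs_mul, abs_of_pos hL, abs_of_pos Real.two_pi_pos]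
    gcongr
    rw [hB, curvatureBound]
    linarith
  -- With `c = pτ + qν`, `m² = p² + q² = ⟨c, J⟩ - ⟨c, J - c⟩`. The first bracket is the integrand of
  -- `arcIntegral_noether`, with zero integral; the factor `4` is `2/3 · 6` from
  -- `quartic_remainder_le`.
  have key : ∀ u ∈ Icc 0 (2 * Real.pi), m ^ 2 ≤ (inner ℝ c (tangent γ u)
        * (curvature γ u * curvatureDeriv γ 2 u - 1 / 2 * curvatureDeriv γ 1 u ^ 2)
      + inner ℝ c (normal γ u) * curvatureDeriv γ 3 u
      + 5 / 2 * (inner ℝ c (tangent γ u) * curvatureDeriv γ 1 u ^ 2)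
      + 2 / 3 * ((curvature γ u - κ) ^ 2
        * (curvature γ u ^ 2 + 2 * curvature γ u * κ + 3 * κ ^ 2)
        * inner ℝ c (tangent γ u)))
      + ((5 / 2 * m) * curvatureDeriv γ 1 u ^ 2
        + m * (2 * X + 4 * (B / L) ^ 2 * (L * (2 * energy γ)))) := by
    intro u hu
    have hR := h.norm_noetherCurrent_sub_le (left_mem_Icc.2 Real.two_pi_pos.le) hu
    have hRt : |inner ℝ (noetherCurrent γ u - c) (tangent γ u)| ≤ X := by
      simpa [h.norm_tangent] using
        (abs_real_inner_le_norm _ (tangent γ u)).trans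
          (mul_le_mul_of_nonneg_right hR (norm_nonneg _))
    have hRn : |inner ℝ (noetherCurrent γ u - c) (normal γ u)| ≤ X := by
      simpa [h.norm_normal] using
        (abs_real_inner_le_norm _ (normal γ u)).trans
          (mul_le_mul_of_nonneg_right hR (norm_nonneg _))
    rw [inner_sub_left, h.inner_noetherCurrent_tangent] at hRt
    rw [inner_sub_left, h.inner_noetherCurrent_normal] at hRn
    have hp : |inner ℝ c (tangent γ u)| ≤ m := by
      simpa [h.norm_tangent] using abs_real_inner_le_norm c (tangent γ u)
    have hq : |inner ℝ c (normal γ u)| ≤ m := by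
      simpa [h.norm_normal] using abs_real_inner_le_norm c (normal γ u)
    have hsq := h.sq_inner_add_sq_inner c u
    have hf := h.sq_curvature_sub_le hw hu
    have hquart := quartic_remainder_le (h.abs_curvature_le hw hE hu) hκle
    set p := inner ℝ c (tangent γ u)
    set q := inner ℝ c (normal γ u)
    set k1 := curvatureDeriv γ 1 u
    set a := curvature γ u * curvatureDeriv γ 2 u - 1 / 2 * k1 ^ 2
    set k3 := curvatureDeriv γ 3 u
    set P := curvature γ u ^ 2 + 2 * curvature γ u * κ + 3 * κ ^ 2
    have e1 : -(p * (a - p)) ≤ m * X := by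
      refine (neg_le_abs _).trans ?_
      rw [abs_mul]
      exact mul_le_mul hp hRt (abs_nonneg _) hm0
    have e2 : -(q * (k3 - q)) ≤ m * X := by
      refine (neg_le_abs _).trans ?_
      rw [abs_mul]
      exact mul_le_mul hq hRn (abs_nonneg _) hm0
    have e3 : -(p * k1 ^ 2) ≤ m * k1 ^ 2 := by
      rw [← neg_mul]
      exact mul_le_mul_of_nonneg_right ((neg_le_abs _).trans hp) (sq_nonneg _)
    have e4 : -((curvature γ u - κ) ^ 2 * P * p)
        ≤ L * (2 * energy γ) * (6 * (B / L) ^ 2) * m := by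
      refine (neg_le_abs _).trans ?_
      rw [abs_mul, abs_mul, abs_of_nonneg (sq_nonneg (curvature γ u - κ))]
      gcongr
    linarith
  have hint := h.arcIntegral_mono continuous_const (by fun_prop) key
  rw [h.arcIntegral_add (by fun_prop) (by fun_prop), h.arcIntegral_noether,
    h.arcIntegral_add (by fun_prop) (by fun_prop), arcIntegral_const, arcIntegral_const_mul,
    arcIntegral_const, arcIntegral_sq_eq, ← hLdef] at hint
  have e5 : 4 * (B / L) ^ 2 * (L * (2 * energy γ)) * L = 4 * B ^ 2 * (2 * energy γ) := by
    field_simp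
  -- The coefficient `5/2` of `m · 2E` is rounded up to `3`; a factor `m` is then cancelled, with `m
  -- = 0` treated apart.
  have hmain : m * (m * L) ≤ m * (2 * X * L + (4 * B ^ 2 + 3) * (2 * energy γ)) := by
    nlinarith [mul_nonneg hm0 hE0]
  rcases hm0.eq_or_lt with h0 | h0
  · rw [← h0, zero_mul, coercivityConst]
    positivity
  · exact le_of_mul_le_mul_left hmain h0

/-- The pointwise bound of `k_{sss}` by `𝒦` and the energy. -/
lemma IsClosedImmersed.abs_curvatureDeriv_three_le (h : IsClosedImmersed γ)
    (hw : windingNumber γ = w) (hE : scaledEnergy γ ≤ coercivityThreshold w) {u : ℝ}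
    (hu : u ∈ Icc 0 (2 * Real.pi)) :
    |curvatureDeriv γ 3 u| ≤ 3 * arcIntegral γ (fun u => |idealOp γ u|)
      + coercivityConst w * (2 * energy γ) / length γ := by
  have hL := h.length_pos
  have h1 := h.norm_noetherCurrent_zero_le hw hE
  rw [← le_div_iff₀ hL, add_div, mul_div_cancel_right₀ _ hL.ne'] at h1
  have h2 := h.norm_noetherCurrent_sub_le (left_mem_Icc.2 Real.two_pi_pos.le) hu
  have h3 := abs_real_inner_le_norm (noetherCurrent γ u) (normal γ u)
  rw [h.inner_noetherCurrent_normal, h.norm_normal, mul_one] at h3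
  have h4 := norm_sub_norm_le (noetherCurrent γ u) (noetherCurrent γ 0)
  linarith

lemma IsClosedImmersed.arcIntegral_sq_le (h : IsClosedImmersed γ) {f : ℝ → ℝ}
    (hf : Continuous f) {M : ℝ} (hM : ∀ u ∈ Icc 0 (2 * Real.pi), |f u| ≤ M) :
    arcIntegral γ (fun u => f u ^ 2) ≤ M ^ 2 * length γ := by
  rw [← arcIntegral_const]
  exact h.arcIntegral_mono (by fun_prop) continuous_const
    fun u hu => sq_le_sq' (abs_le.1 (hM u hu)).1 (abs_le.1 (hM u hu)).2

/-- The pointwise bound on `k_sss` is integrated down to `k_ss` and `k_s`, then squared; smallness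
of `L³E` absorbs the term quadratic in the energy. -/
lemma IsClosedImmersed.coercivity_aux (h : IsClosedImmersed γ)
    (hw : windingNumber γ = w) (hE : scaledEnergy γ ≤ coercivityThreshold w) :
    2 * energy γ ≤ 36 * length γ ^ 6 * idealOpNormSq γ ∧
      arcIntegral γ (fun u => curvatureDeriv γ 2 u ^ 2)
        ≤ 36 * length γ ^ 4 * idealOpNormSq γ := by
  have hL := h.length_pos
  have h3 : ∀ u ∈ Icc 0 (2 * Real.pi), _ := fun u hu => h.abs_curvatureDeriv_three_le hw hE hu
  have h2 := h.abs_curvatureDeriv_le 1 h3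
  have h1 := h.abs_curvatureDeriv_le 0 h2
  have i2 := h.arcIntegral_sq_le (h.continuous_curvatureDeriv 2) h2
  have i1 := h.arcIntegral_sq_le (h.continuous_curvatureDeriv 1) h1
  rw [arcIntegral_sq_eq] at i1
  have hX := h.sq_arcIntegral_abs_le h.continuous_idealOp
  change _ ≤ length γ * idealOpNormSq γ at hX
  have hE0 := energy_nonneg γ
  have hA : 3 ≤ coercivityConst w := by
    unfold coercivityConst
    nlinarith [sq_nonneg (curvatureBound w)]
  unfold scaledEnergy coercivityThreshold at hE
  rw [le_div_iff₀ (by positivity)] at hE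
  set L := length γ
  set X := arcIntegral γ (fun u => |idealOp γ u|)
  set A := coercivityConst w
  set e := 2 * energy γ with he
  set Q := idealOpNormSq γ
  have he0 : 0 ≤ e := by positivity
  -- `(a + b)² ≤ 2a² + 2b²` together with `X² ≤ LQ`.
  have hY : (3 * X + A * e / L) ^ 2 ≤ 18 * (L * Q) + 2 * (A * e / L) ^ 2 := by
    nlinarith [sq_nonneg (3 * X - A * e / L)]
  have hS : L ^ 3 * e * (4 * A ^ 2) ≤ 1 := by
    rw [he]; linarith
  -- The `8A²` in the threshold is chosen so that this term is at most half of the left side `e` of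
  -- `c1`.
  have hZ : 2 * (A * e / L) ^ 2 * L ^ 5 ≤ e / 2 := by
    have : 2 * (A * e / L) ^ 2 * L ^ 5 = e / 2 * (L ^ 3 * e * (4 * A ^ 2)) := by
      field_simp
      ring
    rw [this]
    exact mul_le_of_le_one_right (by positivity) hS
  have c1 : e ≤ 36 * L ^ 6 * Q := by
    have : (L * (L * (3 * X + A * e / L))) ^ 2 * L
        ≤ (18 * (L * Q) + 2 * (A * e / L) ^ 2) * L ^ 5 := by
      have := mul_le_mul_of_nonneg_right hY (pow_nonneg hL.le 5)
      linarith
    linarith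
  refine ⟨c1, ?_⟩
  have c2 : (L * (3 * X + A * e / L)) ^ 2 * L ≤ (18 * (L * Q) + 2 * (A * e / L) ^ 2) * L ^ 3 := by
    have := mul_le_mul_of_nonneg_right hY (pow_nonneg hL.le 3)
    linarith
  have c3 : (18 * (L * Q) + 2 * (A * e / L) ^ 2) * L ^ 3 * L ^ 2 ≤ 36 * L ^ 4 * Q * L ^ 2 := by
    linarith
  exact i2.trans (c2.trans (le_of_mul_le_mul_right c3 (by positivity)))

/-- Coercivity of `𝒦` for small scale-invariant energy. -/
lemma IsClosedImmersed.energy_le (h : IsClosedImmersed γ)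
    (hw : windingNumber γ = w) (hE : scaledEnergy γ ≤ coercivityThreshold w) :
    energy γ ≤ 18 * length γ ^ 6 * idealOpNormSq γ := by
  linarith [(h.coercivity_aux hw hE).1]

/-- Integration by parts: `∫ k k_ssss = ∫ k_ss²` and `∫ k³ k_ss = -3 ∫ k² k_s²`, the latter joined
by `-½ ∫ k² k_s²`. -/
lemma IsClosedImmersed.arcIntegral_curvature_mul_idealOp (h : IsClosedImmersed γ) :
    arcIntegral γ (fun u => curvature γ u * idealOp γ u)
      = arcIntegral γ (fun u => curvatureDeriv γ 2 u ^ 2)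
        + -(7 / 2) * arcIntegral γ (fun u => curvature γ u ^ 2 * curvatureDeriv γ 1 u ^ 2) := by
  have hk := h.contDiff_curvature.continuous
  have hk1 := h.continuous_curvatureDeriv 1
  have hk2 := h.continuous_curvatureDeriv 2
  have hk4 := h.continuous_curvatureDeriv 4
  have h0 := arcIntegral_eq_zero h (G := fun u => curvature γ u * curvatureDeriv γ 3 u
      - curvatureDeriv γ 1 u * curvatureDeriv γ 2 u + curvature γ u ^ 3 * curvatureDeriv γ 1 u)
    (g := fun u => curvature γ u * curvatureDeriv γ 4 u - curvatureDeriv γ 2 u ^ 2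
      + 3 * curvature γ u ^ 2 * curvatureDeriv γ 1 u ^ 2
      + curvature γ u ^ 3 * curvatureDeriv γ 2 u)
    (fun u => by
      have d0 := h.hasDerivAt_curvature u
      have d1 := h.hasDerivAt_curvatureDeriv 1 u
      have d2 := h.hasDerivAt_curvatureDeriv 2 u
      have d3 := h.hasDerivAt_curvatureDeriv 3 u
      refine (((d0.mul d3).sub (d1.mul d2)).add ((d0.pow 3).mul d1)).congr_deriv ?_
      simp only [Pi.pow_apply]
      push_cast
      ring)
    (by fun_prop)
    (fun u => by simp only [h.periodic_curvatureDeriv _ u, h.periodic_curvature u])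
  rw [← arcIntegral_const_mul, ← h.arcIntegral_add (by fun_prop) (by fun_prop),
    ← add_zero (arcIntegral γ (fun u => curvatureDeriv γ 2 u ^ 2 + _)), ← h0,
    ← h.arcIntegral_add (by fun_prop) (by fun_prop)]
  congr 1
  funext u
  simp only [idealOp]
  ring

/-- The two-sided control of the rate `∫ k 𝒦 ds` at which the length decreases. -/
lemma IsClosedImmersed.arcIntegral_curvature_mul_idealOp_le (h : IsClosedImmersed γ)
    (hw : windingNumber γ = w) (hE : scaledEnergy γ ≤ coercivityThreshold w) :
    arcIntegral γ (fun u => curvature γ u * idealOp γ u)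
      ≤ 36 * length γ ^ 4 * idealOpNormSq γ := by
  rw [h.arcIntegral_curvature_mul_idealOp]
  have : 0 ≤ arcIntegral γ (fun u => curvature γ u ^ 2 * curvatureDeriv γ 1 u ^ 2) :=
    arcIntegral_nonneg fun u => by positivity
  linarith [(h.coercivity_aux hw hE).2]

/-- Only the `k² k_s²` term can make the length grow; with `|k| ≤ B/L` and coercivity its
contribution is `7/2 · 36 = 126` times `B² L⁴ Q`. -/
lemma IsClosedImmersed.neg_arcIntegral_curvature_mul_idealOp_le (h : IsClosedImmersed γ)
    (hw : windingNumber γ = w) (hE : scaledEnergy γ ≤ coercivityThreshold w) :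
    -arcIntegral γ (fun u => curvature γ u * idealOp γ u)
      ≤ 126 * curvatureBound w ^ 2 * length γ ^ 4 * idealOpNormSq γ := by
  have hL := h.length_pos
  have hk := h.contDiff_curvature.continuous
  have hk1 := h.continuous_curvatureDeriv 1
  rw [h.arcIntegral_curvature_mul_idealOp]
  have h0 : 0 ≤ arcIntegral γ (fun u => curvatureDeriv γ 2 u ^ 2) :=
    arcIntegral_nonneg fun u => by positivity
  have h1 : arcIntegral γ (fun u => curvature γ u ^ 2 * curvatureDeriv γ 1 u ^ 2)
      ≤ (curvatureBound w / length γ) ^ 2 * (2 * energy γ) := by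
    rw [← arcIntegral_sq_eq, ← arcIntegral_const_mul]
    refine h.arcIntegral_mono (by fun_prop) (by fun_prop) fun u hu => ?_
    have := abs_le.1 (h.abs_curvature_le hw hE hu)
    exact mul_le_mul_of_nonneg_right (sq_le_sq' this.1 this.2) (sq_nonneg _)
  have h2 : (curvatureBound w / length γ) ^ 2 * (2 * energy γ)
      ≤ (curvatureBound w / length γ) ^ 2 * (36 * length γ ^ 6 * idealOpNormSq γ) :=
    mul_le_mul_of_nonneg_left (h.coercivity_aux hw hE).1 (sq_nonneg _)
  have h3 : (curvatureBound w / length γ) ^ 2 * (36 * length γ ^ 6 * idealOpNormSq γ)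
      = 36 * curvatureBound w ^ 2 * length γ ^ 4 * idealOpNormSq γ := by
    field_simp
  linarith

end Static

/-! ### Smooth families on `[0, ∞) × ℝ` -/

section Families

variable {F : Type*} [NormedAddCommGroup F] [NormedSpace ℝ F]

/-- The domain `[0, ∞) × ℝ` of a family of functions. -/
def spaceTime : Set (ℝ × ℝ) := Ici 0 ×ˢ univ

lemma uniqueDiffOn_spaceTime : UniqueDiffOn ℝ spaceTime :=
  (uniqueDiffOn_Ici 0).prod uniqueDiffOn_univ

lemma mem_spaceTime {t : ℝ} (ht : 0 ≤ t) (u : ℝ) : (t, u) ∈ spaceTime := ⟨ht, mem_univ _⟩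

/-- A family `f t`, `t ≥ 0`, that is jointly smooth up to `t = 0`. -/
def SmoothFamily (f : ℝ → ℝ → F) : Prop :=
  ContDiffOn ℝ ∞ (fun p : ℝ × ℝ => f p.1 p.2) spaceTime

/-- The time derivative of a family, one-sided at `t = 0`. -/
noncomputable def timeDeriv (f : ℝ → ℝ → F) (t u : ℝ) : F :=
  derivWithin (fun r => f r u) (Ici 0) t

variable {f g : ℝ → ℝ → F}

lemma SmoothFamily.hasFDerivWithinAt (hf : SmoothFamily f) {t : ℝ} (ht : 0 ≤ t) (u : ℝ) :
    HasFDerivWithinAt (fun p : ℝ × ℝ => f p.1 p.2)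
      (fderivWithin ℝ (fun p : ℝ × ℝ => f p.1 p.2) spaceTime (t, u)) spaceTime (t, u) :=
  (hf.differentiableOn (by simp) _ (mem_spaceTime ht u)).hasFDerivWithinAt

lemma SmoothFamily.hasDerivWithinAt_fderivWithin (hf : SmoothFamily f) {t : ℝ} (ht : 0 ≤ t)
    (u : ℝ) : HasDerivWithinAt (fun r => f r u)
      (fderivWithin ℝ (fun p : ℝ × ℝ => f p.1 p.2) spaceTime (t, u) (1, 0)) (Ici 0) t :=
  (hf.hasFDerivWithinAt ht u).comp_hasDerivWithinAt (f := fun r => (r, u)) t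
    ((hasDerivWithinAt_id t _).prodMk (hasDerivWithinAt_const t _ u))
    (fun _ hr => mem_spaceTime hr u)

lemma SmoothFamily.hasDerivAt_fderivWithin (hf : SmoothFamily f) {t : ℝ} (ht : 0 ≤ t)
    (u : ℝ) : HasDerivAt (f t)
      (fderivWithin ℝ (fun p : ℝ × ℝ => f p.1 p.2) spaceTime (t, u) (0, 1)) u := by
  rw [← hasDerivWithinAt_univ]
  exact (hf.hasFDerivWithinAt ht u).comp_hasDerivWithinAt (f := fun w => (t, w)) u
    ((hasDerivWithinAt_const u _ t).prodMk (hasDerivWithinAt_id u _))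
    (fun w _ => mem_spaceTime ht w)

lemma timeDeriv_eq {t u : ℝ} {f' : F} (h : HasDerivWithinAt (fun r => f r u) f' (Ici 0) t)
    (ht : 0 ≤ t) : timeDeriv f t u = f' :=
  h.derivWithin (uniqueDiffOn_Ici 0 t ht)

lemma SmoothFamily.timeDeriv_eq_fderivWithin (hf : SmoothFamily f) {t : ℝ} (ht : 0 ≤ t) (u : ℝ) :
    timeDeriv f t u = fderivWithin ℝ (fun p : ℝ × ℝ => f p.1 p.2) spaceTime (t, u) (1, 0) :=
  timeDeriv_eq (hf.hasDerivWithinAt_fderivWithin ht u) ht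

lemma SmoothFamily.hasDerivWithinAt_timeDeriv (hf : SmoothFamily f) {t : ℝ} (ht : 0 ≤ t)
    (u : ℝ) : HasDerivWithinAt (fun r => f r u) (timeDeriv f t u) (Ici 0) t := by
  rw [hf.timeDeriv_eq_fderivWithin ht]
  exact hf.hasDerivWithinAt_fderivWithin ht u

lemma SmoothFamily.deriv_eq_fderivWithin (hf : SmoothFamily f) {t : ℝ} (ht : 0 ≤ t) (u : ℝ) :
    deriv (f t) u = fderivWithin ℝ (fun p : ℝ × ℝ => f p.1 p.2) spaceTime (t, u) (0, 1) :=
  (hf.hasDerivAt_fderivWithin ht u).deriv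

lemma SmoothFamily.contDiffOn_fderivWithin (hf : SmoothFamily f) :
    ContDiffOn ℝ ∞ (fderivWithin ℝ (fun p : ℝ × ℝ => f p.1 p.2) spaceTime) spaceTime :=
  ContDiffOn.fderivWithin hf uniqueDiffOn_spaceTime (by simp)

lemma SmoothFamily.deriv (hf : SmoothFamily f) : SmoothFamily fun t => deriv (f t) :=
  ContDiffOn.congr (hf.contDiffOn_fderivWithin.clm_apply contDiffOn_const)
    fun p hp => hf.deriv_eq_fderivWithin hp.1 p.2

lemma SmoothFamily.timeDeriv (hf : SmoothFamily f) : SmoothFamily (timeDeriv f) :=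
  ContDiffOn.congr (hf.contDiffOn_fderivWithin.clm_apply contDiffOn_const)
    fun p hp => hf.timeDeriv_eq_fderivWithin hp.1 p.2

lemma mem_closure_interior_spaceTime {t : ℝ} (ht : 0 ≤ t) (u : ℝ) :
    (t, u) ∈ closure (interior spaceTime) := by
  rw [spaceTime, interior_prod_eq, interior_Ici, interior_univ, closure_prod_eq, closure_Ioi]
  exact ⟨ht, by simp⟩

/-- The time derivative commutes with the space derivative. -/
lemma SmoothFamily.timeDeriv_deriv (hf : SmoothFamily f) {t : ℝ} (ht : 0 ≤ t) (u : ℝ) :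
    IdealCurve.timeDeriv (fun r => _root_.deriv (f r)) t u
      = _root_.deriv (IdealCurve.timeDeriv f t) u := by
  have hm := mem_spaceTime ht u
  have hU := uniqueDiffOn_spaceTime (t, u) hm
  have hd : DifferentiableWithinAt ℝ
      (fderivWithin ℝ (fun p : ℝ × ℝ => f p.1 p.2) spaceTime) spaceTime (t, u) :=
    hf.contDiffOn_fderivWithin.differentiableOn (by simp) _ hm
  have key : ∀ v : ℝ × ℝ, fderivWithin ℝ (fun q =>
        fderivWithin ℝ (fun p : ℝ × ℝ => f p.1 p.2) spaceTime q v) spaceTime (t, u)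
      = (fderivWithin ℝ (fderivWithin ℝ (fun p : ℝ × ℝ => f p.1 p.2) spaceTime)
        spaceTime (t, u)).flip v := by
    intro v
    rw [fderivWithin_clm_apply hU hd (differentiableWithinAt_const v)]
    simp
  rw [hf.deriv.timeDeriv_eq_fderivWithin ht, hf.timeDeriv.deriv_eq_fderivWithin ht,
    fderivWithin_congr (fun p (hp : p ∈ spaceTime) => hf.deriv_eq_fderivWithin hp.1 p.2)
      (hf.deriv_eq_fderivWithin ht u),
    fderivWithin_congr (fun p (hp : p ∈ spaceTime) => hf.timeDeriv_eq_fderivWithin hp.1 p.2)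
      (hf.timeDeriv_eq_fderivWithin ht u), key, key]
  -- Symmetry of second derivatives also holds at `t = 0`, because boundary points lie in the
  -- closure of the interior.
  exact (ContDiffOn.contDiffWithinAt hf hm).isSymmSndFDerivWithinAt
    (by simp [minSmoothness_of_isRCLikeNormedField]; exact WithTop.coe_le_coe.2 le_top)
    uniqueDiffOn_spaceTime (mem_closure_interior_spaceTime ht u) hm _ _

lemma SmoothFamily.hasDerivWithinAt_deriv (hf : SmoothFamily f) {t u : ℝ} (ht : 0 ≤ t)
    (hg : ∀ w, HasDerivWithinAt (fun r => f r w) (g t w) (Ici 0) t) {g' : F}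
    (hg' : HasDerivAt (g t) g' u) :
    HasDerivWithinAt (fun r => _root_.deriv (f r) u) g' (Ici 0) t := by
  have h1 := hf.deriv.hasDerivWithinAt_timeDeriv ht u
  rwa [hf.timeDeriv_deriv ht, show IdealCurve.timeDeriv f t = g t from
    funext fun w => timeDeriv_eq (hg w) ht, hg'.deriv] at h1

lemma SmoothFamily.smul {a : ℝ → ℝ → ℝ} (ha : SmoothFamily a) (hf : SmoothFamily f) :
    SmoothFamily fun t u => a t u • f t u := ContDiffOn.smul ha hf

lemma SmoothFamily.mul {a b : ℝ → ℝ → ℝ} (ha : SmoothFamily a) (hb : SmoothFamily b) :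
    SmoothFamily fun t u => a t u * b t u := ContDiffOn.mul ha hb

lemma SmoothFamily.add (hf : SmoothFamily f) (hg : SmoothFamily g) :
    SmoothFamily fun t u => f t u + g t u := ContDiffOn.add hf hg

lemma SmoothFamily.sub (hf : SmoothFamily f) (hg : SmoothFamily g) :
    SmoothFamily fun t u => f t u - g t u := ContDiffOn.sub hf hg

lemma SmoothFamily.pow {a : ℝ → ℝ → ℝ} (ha : SmoothFamily a) (n : ℕ) :
    SmoothFamily fun t u => a t u ^ n := ContDiffOn.pow ha n

lemma SmoothFamily.const (c : F) : SmoothFamily fun _ _ => c := contDiffOn_const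

lemma SmoothFamily.continuous_max (hf : SmoothFamily f) :
    Continuous fun p : ℝ × ℝ => f (max p.1 0) p.2 := by
  have : Continuous fun p : ℝ × ℝ => (max p.1 0, p.2) := by fun_prop
  exact hf.continuousOn.comp_continuous this fun p => mem_spaceTime (le_max_right _ _) _

lemma SmoothFamily.continuous (hf : SmoothFamily f) {t : ℝ} (ht : 0 ≤ t) : Continuous (f t) :=
  hf.continuousOn.comp_continuous (f := fun u => (t, u)) (by fun_prop)
    fun u => mem_spaceTime ht u

lemma SmoothFamily.continuousOn_integral {a : ℝ → ℝ → ℝ} (ha : SmoothFamily a) (x y : ℝ) :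
    ContinuousOn (fun t => ∫ u in x..y, a t u) (Ici 0) := by
  -- Clamping time at `0` gives a family continuous on the whole line that agrees with `a` for `t ≥
  -- 0`.
  have h1 : Continuous fun t => ∫ u in x..y, a (max t 0) u :=
    intervalIntegral.continuous_parametric_intervalIntegral_of_continuous'
      (f := fun t u => a (max t 0) u) ha.continuous_max _ _
  refine h1.continuousOn.congr fun t ht => ?_
  simp only [max_eq_left (mem_Ici.1 ht)]

/-- Differentiation under the integral sign. -/
lemma SmoothFamily.hasDerivAt_integral {a : ℝ → ℝ → ℝ} (ha : SmoothFamily a) {b : ℝ → ℝ}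
    {t : ℝ} (ht : 0 < t) (x y : ℝ)
    (hb : ∀ u, HasDerivWithinAt (fun r => a r u) (b u) (Ici 0) t) :
    HasDerivAt (fun r => ∫ u in x..y, a r u) (∫ u in x..y, b u) t := by
  have hbt : b = IdealCurve.timeDeriv a t := funext fun u => (timeDeriv_eq (hb u) ht.le).symm
  have hsub : Icc 0 (2 * t) ×ˢ uIcc x y ⊆ spaceTime := fun p hp => mem_spaceTime hp.1.1 p.2
  obtain ⟨C, hC⟩ := (isCompact_Icc.prod isCompact_uIcc).exists_bound_of_continuousOn
    (ha.timeDeriv.continuousOn.mono hsub)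
  rw [hbt]
  have hpos : ∀ᶠ r in 𝓝 t, 0 < r := lt_mem_nhds ht
  refine (intervalIntegral.hasDerivAt_integral_of_dominated_loc_of_deriv_le
    (s := Ioo 0 (2 * t)) (bound := fun _ => C) (Ioo_mem_nhds ht (by linarith))
    (hpos.mono fun r hr => (ha.continuous hr.le).aestronglyMeasurable)
    ((ha.continuous ht.le).intervalIntegrable _ _)
    (ha.timeDeriv.continuous ht.le).aestronglyMeasurable
    (Filter.Eventually.of_forall fun u hu r hr =>
      hC (r, u) ⟨Ioo_subset_Icc_self hr, uIoc_subset_uIcc hu⟩)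
    intervalIntegrable_const
    (Filter.Eventually.of_forall fun u hu r hr => ?_)).2
  exact (ha.hasDerivWithinAt_timeDeriv hr.1.le u).hasDerivAt (Ici_mem_nhds hr.1)

end Families

/-! ### Smoothness of the geometric quantities along the flow -/

section FlowSmooth

variable {γ₀ : ℝ → ℂ} {γ : ℝ → ℝ → ℂ} {F : Type*} [NormedAddCommGroup F] [NormedSpace ℝ F]

lemma IsIdealFlow.smoothFamily (h : IsIdealFlow γ₀ γ) : SmoothFamily γ := h.smooth

lemma IsIdealFlow.smoothFamily_speed (h : IsIdealFlow γ₀ γ) :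
    SmoothFamily fun t u => ‖deriv (γ t) u‖ :=
  ContDiffOn.norm ℝ h.smoothFamily.deriv fun p hp => (h.closed_immersed p.1 hp.1).immersed p.2

lemma IsIdealFlow.smoothFamily_arcDeriv (h : IsIdealFlow γ₀ γ) {f : ℝ → ℝ → F}
    (hf : SmoothFamily f) : SmoothFamily fun t => arcDeriv (γ t) (f t) :=
  SmoothFamily.smul (ContDiffOn.inv h.smoothFamily_speed
    fun p hp => ((h.closed_immersed p.1 hp.1).speed_pos p.2).ne') hf.deriv

lemma IsIdealFlow.smoothFamily_tangent (h : IsIdealFlow γ₀ γ) :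
    SmoothFamily fun t => tangent (γ t) := h.smoothFamily_arcDeriv h.smoothFamily

lemma IsIdealFlow.smoothFamily_normal (h : IsIdealFlow γ₀ γ) :
    SmoothFamily fun t => normal (γ t) := by
  simp only [normal_eq]
  exact ContDiffOn.mul contDiffOn_const h.smoothFamily_tangent

lemma IsIdealFlow.smoothFamily_curvature (h : IsIdealFlow γ₀ γ) :
    SmoothFamily fun t => curvature (γ t) :=
  ContDiffOn.inner ℝ (h.smoothFamily_arcDeriv h.smoothFamily_tangent) h.smoothFamily_normal

lemma IsIdealFlow.smoothFamily_curvatureDeriv (h : IsIdealFlow γ₀ γ) (n : ℕ) :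
    SmoothFamily fun t => curvatureDeriv (γ t) n := by
  induction n with
  | zero => exact h.smoothFamily_curvature
  | succ n ih => simp only [curvatureDeriv_succ]; exact h.smoothFamily_arcDeriv ih

lemma IsIdealFlow.smoothFamily_idealOp (h : IsIdealFlow γ₀ γ) :
    SmoothFamily fun t => idealOp (γ t) :=
  ((h.smoothFamily_curvatureDeriv 4).add ((h.smoothFamily_curvatureDeriv 2).mul
    (h.smoothFamily_curvature.pow 2))).sub (((SmoothFamily.const (1 / 2 : ℝ)).mul
    ((h.smoothFamily_curvatureDeriv 1).pow 2)).mul h.smoothFamily_curvature)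

lemma IsIdealFlow.continuousOn_arcIntegral (h : IsIdealFlow γ₀ γ) {f : ℝ → ℝ → ℝ}
    (hf : SmoothFamily f) : ContinuousOn (fun t => arcIntegral (γ t) (f t)) (Ici 0) :=
  (hf.mul h.smoothFamily_speed).continuousOn_integral _ _

lemma IsIdealFlow.continuousOn_length (h : IsIdealFlow γ₀ γ) :
    ContinuousOn (fun t => length (γ t)) (Ici 0) :=
  h.continuousOn_arcIntegral (SmoothFamily.const (1 : ℝ))

lemma IsIdealFlow.continuousOn_energy (h : IsIdealFlow γ₀ γ) :
    ContinuousOn (fun t => energy (γ t)) (Ici 0) :=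
  continuousOn_const.mul (h.continuousOn_arcIntegral ((h.smoothFamily_curvatureDeriv 1).pow 2))

lemma IsIdealFlow.continuousOn_windingNumber (h : IsIdealFlow γ₀ γ) :
    ContinuousOn (fun t => windingNumber (γ t)) (Ici 0) :=
  continuousOn_const.mul (h.continuousOn_arcIntegral h.smoothFamily_curvature)

lemma IsIdealFlow.continuousOn_idealOpNormSq (h : IsIdealFlow γ₀ γ) :
    ContinuousOn (fun t => idealOpNormSq (γ t)) (Ici 0) :=
  h.continuousOn_arcIntegral (h.smoothFamily_idealOp.pow 2)

end FlowSmooth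

/-! ### Evolution equations -/

section Evolution

variable {γ₀ : ℝ → ℂ} {γ : ℝ → ℝ → ℂ} {t : ℝ}

lemma IsIdealFlow.hasDerivWithinAt_deriv (h : IsIdealFlow γ₀ γ) (ht : 0 ≤ t) (u : ℝ) :
    HasDerivWithinAt (fun r => deriv (γ r) u)
      (‖deriv (γ t) u‖ • (arcDeriv (γ t) (idealOp (γ t)) u • normal (γ t) u
        - (curvature (γ t) u * idealOp (γ t) u) • tangent (γ t) u)) (Ici 0) t := by
  have hγ := h.closed_immersed t ht
  refine h.smoothFamily.hasDerivWithinAt_deriv ht (fun w => h.evolution t ht w)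
    (g := fun t u => idealOp (γ t) u • normal (γ t) u) ?_
  refine ((hγ.hasDerivAt hγ.contDiff_idealOp u).smul (hγ.hasDerivAt_normal u)).congr_deriv ?_
  simp only [Complex.real_smul]
  push_cast
  ring

lemma IsClosedImmersed.speed_smul_tangent {η : ℝ → ℂ} (h : IsClosedImmersed η) (u : ℝ) :
    deriv η u = ‖deriv η u‖ • tangent η u := (h.hasDerivAt_self u).deriv

/-- `∂_t |γ_u| = -k 𝒦 |γ_u|`. -/
lemma IsIdealFlow.hasDerivWithinAt_speed (h : IsIdealFlow γ₀ γ) (ht : 0 ≤ t) (u : ℝ) :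
    HasDerivWithinAt (fun r => ‖deriv (γ r) u‖)
      (-(curvature (γ t) u * idealOp (γ t) u) * ‖deriv (γ t) u‖) (Ici 0) t := by
  have hγ := h.closed_immersed t ht
  -- The speed is already known to be differentiable; its derivative is identified by
  -- differentiating `|γ_u|²` in two ways.
  have hv := h.smoothFamily_speed.hasDerivWithinAt_timeDeriv ht u
  have h1 := (h.hasDerivWithinAt_deriv ht u).norm_sq
  have h2 := (hv.pow 2).derivWithin (uniqueDiffOn_Ici 0 t ht)
  have h3 := h1.derivWithin (uniqueDiffOn_Ici 0 t ht)
  have h4 := h2.symm.trans h3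
  conv_rhs at h4 => rw [hγ.speed_smul_tangent u]
  simp only [real_inner_smul_left, real_inner_smul_right, inner_sub_right, norm_smul,
    hγ.norm_tangent, hγ.inner_tangent_self, real_inner_comm (normal (γ t) u),
    inner_normal_tangent, norm_norm] at h4
  have hpos := hγ.speed_pos u
  refine hv.congr_deriv ?_
  have h5 : (2 * ‖deriv (γ t) u‖) * timeDeriv (fun t u => ‖deriv (γ t) u‖) t u
      = (2 * ‖deriv (γ t) u‖)
        * (-(curvature (γ t) u * idealOp (γ t) u) * ‖deriv (γ t) u‖) := by
    norm_num at h4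
    linarith
  exact mul_left_cancel₀ (by positivity) h5

/-- `∂_t τ = 𝒦_s ν`. -/
lemma IsIdealFlow.hasDerivWithinAt_tangent (h : IsIdealFlow γ₀ γ) (ht : 0 ≤ t) (u : ℝ) :
    HasDerivWithinAt (fun r => tangent (γ r) u)
      (arcDeriv (γ t) (idealOp (γ t)) u • normal (γ t) u) (Ici 0) t := by
  have hγ := h.closed_immersed t ht
  have hne : (‖deriv (γ t) u‖ : ℂ) ≠ 0 := by exact_mod_cast (hγ.speed_pos u).ne'
  have := ((h.hasDerivWithinAt_speed ht u).fun_inv (hγ.speed_pos u).ne').smul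
    (h.hasDerivWithinAt_deriv ht u)
  refine this.congr_deriv ?_
  rw [hγ.speed_smul_tangent u]
  simp only [Complex.real_smul, norm_mul, Complex.norm_real, norm_norm, hγ.norm_tangent, mul_one]
  push_cast
  field_simp
  ring

/-- `∂_t ν = -𝒦_s τ`. -/
lemma IsIdealFlow.hasDerivWithinAt_normal (h : IsIdealFlow γ₀ γ) (ht : 0 ≤ t) (u : ℝ) :
    HasDerivWithinAt (fun r => normal (γ r) u)
      (-(arcDeriv (γ t) (idealOp (γ t)) u • tangent (γ t) u)) (Ici 0) t := by
  simp only [normal_eq]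
  refine ((h.hasDerivWithinAt_tangent ht u).const_mul Complex.I).congr_deriv ?_
  simp only [Complex.real_smul, normal_eq]
  linear_combination (↑(arcDeriv (γ t) (idealOp (γ t)) u) * tangent (γ t) u) * Complex.I_sq

/-- `∂_t (k |γ_u|) = 𝒦_ss |γ_u|`. -/
lemma IsIdealFlow.hasDerivWithinAt_curvature_mul_speed (h : IsIdealFlow γ₀ γ) (ht : 0 ≤ t)
    (u : ℝ) : HasDerivWithinAt (fun r => curvature (γ r) u * ‖deriv (γ r) u‖)
      (arcDeriv (γ t) (arcDeriv (γ t) (idealOp (γ t))) u * ‖deriv (γ t) u‖) (Ici 0) t := by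
  have hγ := h.closed_immersed t ht
  have h1 := h.smoothFamily_tangent.hasDerivWithinAt_deriv ht
    (g := fun t u => arcDeriv (γ t) (idealOp (γ t)) u • normal (γ t) u)
    (fun w => h.hasDerivWithinAt_tangent ht w)
    ((hγ.hasDerivAt (hγ.contDiff_arcDeriv hγ.contDiff_idealOp) u).smul (hγ.hasDerivAt_normal u))
  have h2 := h1.inner ℝ (h.hasDerivWithinAt_normal ht u)
  have h3 : ∀ r ∈ Ici (0 : ℝ), curvature (γ r) u * ‖deriv (γ r) u‖
      = inner ℝ (deriv (tangent (γ r)) u) (normal (γ r) u) := by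
    intro r hr
    have hr := h.closed_immersed r hr
    rw [(hr.hasDerivAt_tangent u).deriv, real_inner_smul_left, hr.inner_normal_self, mul_one]
  refine (h2.congr h3 (h3 t ht)).congr_deriv ?_
  rw [(hγ.hasDerivAt_tangent u).deriv]
  simp only [real_inner_smul_left, real_inner_smul_right, inner_add_left, inner_neg_right,
    hγ.inner_normal_self, real_inner_comm (normal (γ t) u) (tangent (γ t) u),
    inner_normal_tangent]
  ring

/-- Used with `v = |γ_u|`: `∂_t` commutes with `∂_u` but not with `∂_s`, so `k |γ_u|` and `k_s |γ_u|
= k_u` are differentiated first and the speed divided out afterwards. -/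
lemma hasDerivWithinAt_of_mul_right {f v : ℝ → ℝ} {fv' v' s : ℝ} {S : Set ℝ}
    (hfv : HasDerivWithinAt (fun r => f r * v r) fv' S s) (hv : HasDerivWithinAt v v' S s)
    (hne : ∀ r ∈ S, v r ≠ 0) (hs : s ∈ S) :
    HasDerivWithinAt f ((fv' - f s * v') / v s) S s := by
  have h1 := hfv.fun_div hv (hne s hs)
  refine (h1.congr (fun r hr => (mul_div_cancel_right₀ _ (hne r hr)).symm)
    (mul_div_cancel_right₀ _ (hne s hs)).symm).congr_deriv ?_
  have := hne s hs
  field_simp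

lemma IsIdealFlow.speed_ne_zero (h : IsIdealFlow γ₀ γ) (u : ℝ) :
    ∀ r ∈ Ici (0 : ℝ), ‖deriv (γ r) u‖ ≠ 0 :=
  fun r hr => ((h.closed_immersed r hr).speed_pos u).ne'

/-- `∂_t k = 𝒦_ss + k² 𝒦`. -/
lemma IsIdealFlow.hasDerivWithinAt_curvature (h : IsIdealFlow γ₀ γ) (ht : 0 ≤ t) (u : ℝ) :
    HasDerivWithinAt (fun r => curvature (γ r) u)
      (arcDeriv (γ t) (arcDeriv (γ t) (idealOp (γ t))) u
        + curvature (γ t) u ^ 2 * idealOp (γ t) u) (Ici 0) t := by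
  have hne := h.speed_ne_zero u t ht
  refine (hasDerivWithinAt_of_mul_right (h.hasDerivWithinAt_curvature_mul_speed ht u)
    (h.hasDerivWithinAt_speed ht u) (h.speed_ne_zero u) ht).congr_deriv ?_
  field_simp
  ring

/-- The evolution of the curvature derivative along the flow. -/
lemma IsIdealFlow.hasDerivWithinAt_curvatureDeriv_one (h : IsIdealFlow γ₀ γ) (ht : 0 ≤ t)
    (u : ℝ) : HasDerivWithinAt (fun r => curvatureDeriv (γ r) 1 u)
      (arcDeriv (γ t) (fun w => arcDeriv (γ t) (arcDeriv (γ t) (idealOp (γ t))) w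
        + curvature (γ t) w ^ 2 * idealOp (γ t) w) u
        + curvature (γ t) u * idealOp (γ t) u * curvatureDeriv (γ t) 1 u) (Ici 0) t := by
  have hγ := h.closed_immersed t ht
  have hne := h.speed_ne_zero u t ht
  have h1 := h.smoothFamily_curvature.hasDerivWithinAt_deriv ht
    (g := fun t w => arcDeriv (γ t) (arcDeriv (γ t) (idealOp (γ t))) w
      + curvature (γ t) w ^ 2 * idealOp (γ t) w)
    (fun w => h.hasDerivWithinAt_curvature ht w)
    (hγ.hasDerivAt ((hγ.contDiff_arcDeriv (hγ.contDiff_arcDeriv hγ.contDiff_idealOp)).add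
      ((hγ.contDiff_curvature.pow 2).mul hγ.contDiff_idealOp)) u)
  have h2 : ∀ r ∈ Ici (0 : ℝ), curvatureDeriv (γ r) 1 u * ‖deriv (γ r) u‖
      = deriv (curvature (γ r)) u :=
    fun r hr => ((h.closed_immersed r hr).hasDerivAt_curvature u).deriv.symm
  refine (hasDerivWithinAt_of_mul_right (h1.congr h2 (h2 t ht))
    (h.hasDerivWithinAt_speed ht u) (h.speed_ne_zero u) ht).congr_deriv ?_
  field_simp
  ring

lemma IsIdealFlow.hasDerivAt_length (h : IsIdealFlow γ₀ γ) (ht : 0 < t) :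
    HasDerivAt (fun r => length (γ r))
      (-arcIntegral (γ t) (fun u => curvature (γ t) u * idealOp (γ t) u)) t := by
  have h1 := ((SmoothFamily.const (1 : ℝ)).mul h.smoothFamily_speed).hasDerivAt_integral ht 0
    (2 * Real.pi) (fun u => (h.hasDerivWithinAt_speed ht.le u).const_mul 1)
  refine h1.congr_deriv ?_
  rw [← neg_one_mul, ← arcIntegral_const_mul]
  simp [arcIntegral]

lemma IsIdealFlow.hasDerivAt_windingNumber (h : IsIdealFlow γ₀ γ) (ht : 0 < t) :
    HasDerivAt (fun r => windingNumber (γ r)) 0 t := by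
  have hγ := h.closed_immersed t ht.le
  have hF := hγ.contDiff_arcDeriv hγ.contDiff_idealOp
  have h1 := ((h.smoothFamily_curvature.mul h.smoothFamily_speed).hasDerivAt_integral ht 0
    (2 * Real.pi) (fun u => h.hasDerivWithinAt_curvature_mul_speed ht.le u)).const_mul
    (1 / (2 * Real.pi))
  -- `𝒦_ss` is an exact arclength derivative of a periodic function.
  have h2 : arcIntegral (γ t) (arcDeriv (γ t) (arcDeriv (γ t) (idealOp (γ t)))) = 0 :=
    arcIntegral_eq_zero hγ (hγ.hasDerivAt hF) (hγ.contDiff_arcDeriv hF).continuous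
      (hγ.periodic_arcDeriv hγ.periodic_idealOp)
  refine h1.congr_deriv ?_
  change 1 / (2 * Real.pi) * arcIntegral (γ t) _ = 0
  rw [h2, mul_zero]

/-- The ideal curve flow is the gradient flow of the energy. -/
lemma IsIdealFlow.hasDerivAt_energy (h : IsIdealFlow γ₀ γ) (ht : 0 < t) :
    HasDerivAt (fun r => energy (γ r)) (-idealOpNormSq (γ t)) t := by
  have hγ := h.closed_immersed t ht.le
  set K := idealOp (γ t) with hK
  set K1 := arcDeriv (γ t) K with hK1
  set K2 := arcDeriv (γ t) K1 with hK2
  set G := fun w => K2 w + curvature (γ t) w ^ 2 * K w with hG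
  have cK : ContDiff ℝ ∞ K := hγ.contDiff_idealOp
  have cK1 : ContDiff ℝ ∞ K1 := hγ.contDiff_arcDeriv cK
  have cK2 : ContDiff ℝ ∞ K2 := hγ.contDiff_arcDeriv cK1
  have cG : ContDiff ℝ ∞ G := cK2.add ((hγ.contDiff_curvature.pow 2).mul cK)
  have cG1 := (hγ.contDiff_arcDeriv cG).continuous
  have pK : Function.Periodic K _ := hγ.periodic_idealOp
  have pK1 : Function.Periodic K1 _ := hγ.periodic_arcDeriv pK
  have pK2 : Function.Periodic K2 _ := hγ.periodic_arcDeriv pK1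
  have ck := hγ.contDiff_curvature.continuous
  have ck1 := hγ.continuous_curvatureDeriv 1
  have cKc := cK.continuous
  have h1 := (((h.smoothFamily_curvatureDeriv 1).pow 2).mul
    h.smoothFamily_speed).hasDerivAt_integral ht 0 (2 * Real.pi)
    (fun u => ((h.hasDerivWithinAt_curvatureDeriv_one ht.le u).fun_pow 2).mul
      (h.hasDerivWithinAt_speed ht.le u))
  have h2 := h1.const_mul (1 / 2 : ℝ)
  refine h2.congr_deriv ?_
  -- With `G = ∂_t k`, repeated integration by parts moves all derivatives off `𝒦`. The term `½ k_s²
  -- k 𝒦` is what remains of the commutator after the change of `ds`, and the factor multiplying `𝒦`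
  -- becomes `-𝒦`.
  have h3 : arcIntegral (γ t) (fun u => (curvatureDeriv (γ t) 1 u * arcDeriv (γ t) G u
      + 1 / 2 * curvatureDeriv (γ t) 1 u ^ 2 * curvature (γ t) u * K u) + K u ^ 2) = 0 := by
    refine arcIntegral_eq_zero hγ (G := fun u => curvatureDeriv (γ t) 1 u * G u
      - curvatureDeriv (γ t) 2 u * K1 u + curvatureDeriv (γ t) 3 u * K u)
      (fun u => ?_) (by fun_prop) (fun u => ?_)
    · have d1 := hγ.hasDerivAt_curvatureDeriv 1 u
      have d2 := hγ.hasDerivAt_curvatureDeriv 2 u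
      have d3 := hγ.hasDerivAt_curvatureDeriv 3 u
      refine (((d1.mul (hγ.hasDerivAt cG u)).sub (d2.mul (hγ.hasDerivAt cK1 u))).add
        (d3.mul (hγ.hasDerivAt cK u))).congr_deriv ?_
      rw [← hK1, ← hK2]
      have hKu : K u = curvatureDeriv (γ t) 4 u + curvatureDeriv (γ t) 2 u * curvature (γ t) u ^ 2
        - 1 / 2 * curvatureDeriv (γ t) 1 u ^ 2 * curvature (γ t) u := rfl
      have hGu : G u = K2 u + curvature (γ t) u ^ 2 * K u := rfl
      rw [hGu]
      linear_combination (-(K u * ‖deriv (γ t) u‖)) * hKu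
    · simp only [hG, hγ.periodic_curvatureDeriv _ u, hγ.periodic_curvature u, pK u, pK1 u, pK2 u]
  rw [hγ.arcIntegral_add (by fun_prop) (by fun_prop)] at h3
  rw [show idealOpNormSq (γ t) = arcIntegral (γ t) (fun u => K u ^ 2) from rfl,
    ← eq_neg_of_add_eq_zero_left h3, ← intervalIntegral.integral_const_mul]
  refine intervalIntegral.integral_congr fun u _ => ?_
  push_cast
  ring

lemma le_of_hasDerivAt_nonpos {f f' : ℝ → ℝ} {a b : ℝ} (hab : a ≤ b)
    (hc : ContinuousOn f (Icc a b)) (hd : ∀ r ∈ Ioo a b, HasDerivAt f (f' r) r)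
    (hn : ∀ r ∈ Ioo a b, f' r ≤ 0) : f b ≤ f a := by
  refine antitoneOn_of_deriv_nonpos (convex_Icc a b) hc ?_ ?_ (left_mem_Icc.2 hab)
    (right_mem_Icc.2 hab) hab
  · rw [interior_Icc]
    exact fun r hr => (hd r hr).differentiableAt.differentiableWithinAt
  · rw [interior_Icc]
    exact fun r hr => (hd r hr).deriv.trans_le (hn r hr)

lemma IsIdealFlow.windingNumber_eq (h : IsIdealFlow γ₀ γ) (ht : 0 ≤ t) :
    windingNumber (γ t) = windingNumber γ₀ := by
  have hc : ContinuousOn _ (Icc 0 t) := h.continuousOn_windingNumber.mono Icc_subset_Ici_self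
  have hd : ∀ r ∈ Ioo 0 t, HasDerivAt (fun r => windingNumber (γ r)) 0 r :=
    fun r hr => h.hasDerivAt_windingNumber hr.1
  have h1 := le_of_hasDerivAt_nonpos ht hc hd fun _ _ => le_rfl
  have h2 := le_of_hasDerivAt_nonpos ht hc.neg (fun r hr => (hd r hr).neg)
    fun _ _ => neg_zero.le
  simp only [Pi.neg_apply, h.initial] at h1 h2
  linarith

end Evolution

/-! ### Monotonicity of `L³E` and the length bounds -/

section LongTime

/-- A barrier argument: a function that is nonincreasing wherever it lies below a threshold, and
that starts below the threshold, never exceeds its initial value. -/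
lemma le_initial_of_nonincreasing_below {f f' : ℝ → ℝ} {ε : ℝ} (hc : ContinuousOn f (Ici 0))
    (h0 : f 0 < ε) (hd : ∀ r, 0 < r → HasDerivAt f (f' r) r)
    (hn : ∀ r, 0 < r → f r < ε → f' r ≤ 0) {t : ℝ} (ht : 0 ≤ t) : f t ≤ f 0 := by
  by_contra! hlt
  -- `c` lies strictly between `f 0` and both `f t` and `ε`. Before the first time `s` with `f s ≥
  -- c`, `f` is below `ε` and hence nonincreasing, which forces `f s ≤ f 0 < c`.
  obtain ⟨c, hc0, hc1⟩ := exists_between (lt_min hlt h0)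
  have hcI : ContinuousOn f (Icc 0 t) := hc.mono Icc_subset_Ici_self
  set A := Icc 0 t ∩ f ⁻¹' Ici c with hA
  have hAc : IsCompact A := isCompact_Icc.of_isClosed_subset
    (hcI.preimage_isClosed_of_isClosed isClosed_Icc isClosed_Ici) inter_subset_left
  have hAn : A.Nonempty := ⟨t, right_mem_Icc.2 ht, (hc1.trans_le (min_le_left _ _)).le⟩
  have hs := hAc.sInf_mem hAn
  set s := sInf A
  have hlow : ∀ r ∈ Ioo 0 s, f r < c := by
    intro r hr
    by_contra! hge
    exact absurd (csInf_le hAc.bddBelow ⟨⟨hr.1.le, hr.2.le.trans hs.1.2⟩, hge⟩)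
      (not_le.2 hr.2)
  have := le_of_hasDerivAt_nonpos hs.1.1 (hc.mono Icc_subset_Ici_self)
    (fun r hr => hd r hr.1)
    (fun r hr => hn r hr.1 ((hlow r hr).trans (hc1.trans_le (min_le_right _ _))))
  exact absurd hs.2 (not_le.2 (this.trans_lt hc0))

lemma sub_le_integral_of_hasDerivAt {f f' φ : ℝ → ℝ} {t : ℝ} (ht : 0 ≤ t)
    (hc : ContinuousOn f (Ici 0)) (hφ : ContinuousOn φ (Ici 0))
    (hd : ∀ r, 0 < r → HasDerivAt f (f' r) r) (hle : ∀ r, 0 < r → f' r ≤ φ r) :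
    f t - f 0 ≤ ∫ r in (0 : ℝ)..t, φ r :=
  intervalIntegral.sub_le_integral_of_hasDeriv_right_of_le ht (hc.mono Icc_subset_Ici_self)
    (fun r hr => (hd r hr.1).hasDerivWithinAt)
    ((hφ.mono Icc_subset_Ici_self).integrableOn_Icc) (fun r hr => hle r hr.1)

/-- The smallness threshold for the monotonicity of the scale-invariant energy. -/
noncomputable def monotonicityThreshold (w : ℝ) : ℝ :=
  min (coercivityThreshold w / 2) (1 / (756 * curvatureBound w ^ 2))

lemma curvatureBound_pos (w : ℝ) : 0 < curvatureBound w :=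
  zero_lt_one.trans_le (one_le_curvatureBound w)

lemma monotonicityThreshold_pos (w : ℝ) : 0 < monotonicityThreshold w := by
  have := curvatureBound_pos w
  exact lt_min (half_pos (coercivityThreshold_pos w)) (by positivity)

lemma monotonicityThreshold_lt (w : ℝ) : monotonicityThreshold w < coercivityThreshold w :=
  (min_le_left _ _).trans_lt (half_lt_self (coercivityThreshold_pos w))

variable {γ₀ : ℝ → ℂ} {γ : ℝ → ℝ → ℂ} {w t : ℝ}

lemma scaledEnergy_nonneg {η : ℝ → ℂ} (h : IsClosedImmersed η) : 0 ≤ scaledEnergy η :=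
  mul_nonneg (pow_nonneg h.length_pos.le 3) (energy_nonneg η)

lemma IsIdealFlow.hasDerivAt_scaledEnergy (h : IsIdealFlow γ₀ γ) (ht : 0 < t) :
    HasDerivAt (fun r => scaledEnergy (γ r))
      (3 * length (γ t) ^ 2 * -arcIntegral (γ t) (fun u => curvature (γ t) u * idealOp (γ t) u)
        * energy (γ t) + length (γ t) ^ 3 * -idealOpNormSq (γ t)) t := by
  refine (((h.hasDerivAt_length ht).fun_pow 3).mul (h.hasDerivAt_energy ht)).congr_deriv ?_
  norm_num

lemma IsIdealFlow.continuousOn_scaledEnergy (h : IsIdealFlow γ₀ γ) :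
    ContinuousOn (fun r => scaledEnergy (γ r)) (Ici 0) :=
  (h.continuousOn_length.pow 3).mul h.continuousOn_energy

/-- The rate of change of the scale-invariant energy below the threshold. -/
lemma IsClosedImmersed.scaledEnergy_rate_le {η : ℝ → ℂ} (h : IsClosedImmersed η)
    (hw : windingNumber η = w) (hE : scaledEnergy η ≤ monotonicityThreshold w) :
    3 * length η ^ 2 * -arcIntegral η (fun u => curvature η u * idealOp η u)
        * energy η + length η ^ 3 * -idealOpNormSq η
      ≤ -(1 / 2) * (length η ^ 3 * idealOpNormSq η) := by
  have hL := h.length_pos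
  have hB := curvatureBound_pos w
  have hQ := idealOpNormSq_nonneg η
  have hE0 := energy_nonneg η
  have h1 := h.neg_arcIntegral_curvature_mul_idealOp_le hw
    (hE.trans (monotonicityThreshold_lt w).le)
  have h2 : scaledEnergy η * (756 * curvatureBound w ^ 2) ≤ 1 :=
    (le_div_iff₀ (by positivity)).1 (hE.trans (min_le_right _ _))
  unfold scaledEnergy at h2
  -- The length term is at most `378 B² (L³E) · L³Q`; since `756 = 2 · 378`, the threshold makes
  -- this at most half of the dissipation `L³Q`.
  have h3 := mul_le_mul_of_nonneg_left h1
    (show 0 ≤ 3 * length η ^ 2 * energy η by positivity)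
  have h4 := mul_le_mul_of_nonneg_right h2
    (show 0 ≤ 1 / 2 * (length η ^ 3 * idealOpNormSq η) by positivity)
  linarith

lemma IsIdealFlow.scaledEnergy_le (h : IsIdealFlow γ₀ γ) (hw : windingNumber γ₀ = w)
    (hE : scaledEnergy γ₀ < monotonicityThreshold w) (ht : 0 ≤ t) :
    scaledEnergy (γ t) ≤ scaledEnergy γ₀ := by
  rw [← h.initial] at hE ⊢
  refine le_initial_of_nonincreasing_below h.continuousOn_scaledEnergy hE
    (fun r hr => h.hasDerivAt_scaledEnergy hr) (fun r hr hlt => ?_) ht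
  have hr' := h.closed_immersed r hr.le
  refine (hr'.scaledEnergy_rate_le ((h.windingNumber_eq hr.le).trans hw) hlt.le).trans ?_
  have := mul_nonneg (pow_nonneg hr'.length_pos.le 3) (idealOpNormSq_nonneg (γ r))
  linarith

lemma IsIdealFlow.continuousOn_length_pow_mul (h : IsIdealFlow γ₀ γ) :
    ContinuousOn (fun r => length (γ r) ^ 3 * idealOpNormSq (γ r)) (Ici 0) :=
  (h.continuousOn_length.pow 3).mul h.continuousOn_idealOpNormSq

lemma IsIdealFlow.integral_le (h : IsIdealFlow γ₀ γ) (hw : windingNumber γ₀ = w)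
    (hE : scaledEnergy γ₀ < monotonicityThreshold w) (ht : 0 ≤ t) :
    ∫ r in (0 : ℝ)..t, length (γ r) ^ 3 * idealOpNormSq (γ r)
      ≤ 2 * (scaledEnergy γ₀ - scaledEnergy (γ t)) := by
  have := sub_le_integral_of_hasDerivAt ht h.continuousOn_scaledEnergy
    (h.continuousOn_length_pow_mul.const_smul (-(1 / 2 : ℝ)))
    (fun r hr => h.hasDerivAt_scaledEnergy hr)
    (fun r hr => (h.closed_immersed r hr.le).scaledEnergy_rate_le
      ((h.windingNumber_eq hr.le).trans hw) ((h.scaledEnergy_le hw hE hr.le).trans hE.le))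
  simp only [Pi.smul_apply, smul_eq_mul, intervalIntegral.integral_const_mul, h.initial] at this
  linarith

lemma IsIdealFlow.hasDerivAt_log_length (h : IsIdealFlow γ₀ γ) (ht : 0 < t) :
    HasDerivAt (fun r => Real.log (length (γ r)))
      (-arcIntegral (γ t) (fun u => curvature (γ t) u * idealOp (γ t) u) / length (γ t)) t :=
  (h.hasDerivAt_length ht).log (h.closed_immersed t ht.le).length_pos.ne'

lemma IsIdealFlow.continuousOn_log_length (h : IsIdealFlow γ₀ γ) :
    ContinuousOn (fun r => Real.log (length (γ r))) (Ici 0) :=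
  h.continuousOn_length.log fun r hr => (h.closed_immersed r hr).length_pos.ne'

/-- Here `(log L)' ≤ 126 B² L³Q`, and `integral_le` contributes the factor `2`. -/
lemma IsIdealFlow.log_length_sub_le (h : IsIdealFlow γ₀ γ) (hw : windingNumber γ₀ = w)
    (hE : scaledEnergy γ₀ < monotonicityThreshold w) (ht : 0 ≤ t) :
    Real.log (length (γ t)) - Real.log (length γ₀)
      ≤ 252 * curvatureBound w ^ 2 * scaledEnergy γ₀ := by
  have h1 := sub_le_integral_of_hasDerivAt ht h.continuousOn_log_length
    (h.continuousOn_length_pow_mul.const_smul (126 * curvatureBound w ^ 2))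
    (fun r hr => h.hasDerivAt_log_length hr) (fun r hr => by
      have hr' := h.closed_immersed r hr.le
      have := hr'.neg_arcIntegral_curvature_mul_idealOp_le
        ((h.windingNumber_eq hr.le).trans hw)
        (((h.scaledEnergy_le hw hE hr.le).trans hE.le).trans (monotonicityThreshold_lt w).le)
      rw [div_le_iff₀ hr'.length_pos, Pi.smul_apply, smul_eq_mul]
      linarith)
  simp only [Pi.smul_apply, smul_eq_mul, intervalIntegral.integral_const_mul, h.initial] at h1
  have h2 := h.integral_le hw hE ht
  have h3 := scaledEnergy_nonneg (h.closed_immersed t ht)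
  have h4 := mul_le_mul_of_nonneg_left
    (h2.trans (show _ ≤ 2 * scaledEnergy γ₀ by linarith))
    (show 0 ≤ 126 * curvatureBound w ^ 2 by positivity)
  linarith

/-- The opposite rate is `-(log L)' ≤ 36 L³Q`, again doubled by `integral_le`. -/
lemma IsIdealFlow.sub_log_length_le (h : IsIdealFlow γ₀ γ) (hw : windingNumber γ₀ = w)
    (hE : scaledEnergy γ₀ < monotonicityThreshold w) (ht : 0 ≤ t) :
    Real.log (length γ₀) - Real.log (length (γ t)) ≤ 72 * scaledEnergy γ₀ := by
  have h1 := sub_le_integral_of_hasDerivAt ht h.continuousOn_log_length.fun_neg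
    (h.continuousOn_length_pow_mul.const_smul (36 : ℝ))
    (fun r hr => (h.hasDerivAt_log_length hr).fun_neg) (fun r hr => by
      have hr' := h.closed_immersed r hr.le
      have := hr'.arcIntegral_curvature_mul_idealOp_le
        ((h.windingNumber_eq hr.le).trans hw)
        (((h.scaledEnergy_le hw hE hr.le).trans hE.le).trans (monotonicityThreshold_lt w).le)
      rw [neg_div, neg_neg, div_le_iff₀ hr'.length_pos, Pi.smul_apply, smul_eq_mul]
      linarith)
  simp only [Pi.smul_apply, smul_eq_mul, intervalIntegral.integral_const_mul, h.initial] at h1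
  have h2 := h.integral_le hw hE ht
  have h3 := scaledEnergy_nonneg (h.closed_immersed t ht)
  linarith

end LongTime

end IdealCurve

/-- For each winding number `ω` there are constants `ε₀, Cω` (coercivity), `ε₁, ε₂, C₀`
(preservation of smallness and integral estimate) and `C₁`, `C₃` such that the length along
every ideal curve flow of winding number `ω` with `(L³E)[γ₀] < ε₂` is bounded from above and
from below as stated in the last two clauses. -/
theorem proposition7p4 (ω : ℤ) :
    ∃ ε₀ Cω ε₁ ε₂ C₀ C₁ : ℝ, ∃ C₃ : ℝ → ℝ → ℝ,
      0 < ε₂ ∧ ε₂ ≤ ε₁ ∧ ε₁ < ε₀ ∧ 0 < Cω ∧ 0 < C₀ ∧ 0 < C₁ ∧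
      -- `ε₀`: coercivity of `𝒦` for small scale-invariant energy
      (∀ η : ℝ → ℂ, IdealCurve.IsClosedImmersed η → IdealCurve.windingNumber η = (ω : ℝ) →
        IdealCurve.scaledEnergy η < ε₀ →
        Cω * (IdealCurve.energy η / IdealCurve.length η ^ 6) ≤ IdealCurve.idealOpNormSq η) ∧
      ∀ (γ₀ : ℝ → ℂ) (γ : ℝ → ℝ → ℂ), IdealCurve.IsClosedImmersed γ₀ →
        IdealCurve.windingNumber γ₀ = (ω : ℝ) → IdealCurve.IsIdealFlow γ₀ γ →
        -- `ε₁`: the scale-invariant energy stays below its initial value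
        (IdealCurve.scaledEnergy γ₀ < ε₁ → ∀ t, 0 ≤ t →
          IdealCurve.scaledEnergy (γ t) ≤ IdealCurve.scaledEnergy γ₀) ∧
        (IdealCurve.scaledEnergy γ₀ < ε₂ → ∀ t, 0 ≤ t →
          -- `ε₂`: the integral estimate
          (IntervalIntegrable
              (fun r => IdealCurve.length (γ r) ^ 3 * IdealCurve.idealOpNormSq (γ r))
              MeasureTheory.volume 0 t ∧
            ∫ r in (0 : ℝ)..t, IdealCurve.length (γ r) ^ 3 * IdealCurve.idealOpNormSq (γ r)
              ≤ C₀ * (IdealCurve.scaledEnergy γ₀ - IdealCurve.scaledEnergy (γ t))) ∧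
          -- the upper bound for the length
          IdealCurve.length (γ t)
            ≤ IdealCurve.length γ₀ * Real.exp (C₁ * IdealCurve.scaledEnergy γ₀) ∧
          -- the lower bound for the length
          IdealCurve.length γ₀
              * Real.exp (-(C₃ (IdealCurve.energy γ₀) (IdealCurve.length γ₀)))
            ≤ IdealCurve.length (γ t)) := by
  open IdealCurve in
  -- The thresholds `ε₁` and `ε₂` coincide, and the lower length bound holds with `C₃` equal to `72`
  -- times the initial `L³E`.
  refine ⟨coercivityThreshold ω, 1 / 18, monotonicityThreshold ω, monotonicityThreshold ω, 2,
    252 * curvatureBound ω ^ 2, fun e l => 72 * (l ^ 3 * e), monotonicityThreshold_pos _, le_rfl,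
    monotonicityThreshold_lt _, by norm_num, by norm_num, ?_, fun η hη hw hE => ?_,
    fun γ₀ γ h₀ hw h => ⟨fun hE t ht => h.scaledEnergy_le hw hE ht, fun hE t ht => ?_⟩⟩
  · have := curvatureBound_pos ω
    positivity
  · have := hη.length_pos
    rw [← mul_div_assoc, div_le_iff₀ (by positivity)]
    linarith [hη.energy_le hw hE.le]
  · have hL := h₀.length_pos
    have hLt := (h.closed_immersed t ht).length_pos
    refine ⟨⟨ContinuousOn.intervalIntegrable ?_, h.integral_le hw hE ht⟩, ?_, ?_⟩
    · rw [Set.uIcc_of_le ht]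
      exact h.continuousOn_length_pow_mul.mono Set.Icc_subset_Ici_self
    · rw [← Real.log_le_log_iff hLt (by positivity), Real.log_mul hL.ne' (Real.exp_ne_zero _),
        Real.log_exp]
      linarith [h.log_length_sub_le hw hE ht]
    · rw [← Real.log_le_log_iff (by positivity) hLt, Real.log_mul hL.ne' (Real.exp_ne_zero _),
        Real.log_exp]
      have := h.sub_log_length_le hw hE ht
      rw [scaledEnergy] at this
      linarith
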